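/- Let $N\in\mathbb N$ and $1<p<N$. For an open set $\Omega\subset\mathbb R^N$ let $$\mathrm{Cap}_p(\Omega)=\inf\Big\{\int_{\mathbb R^N}|\nabla u|^p\,dx : u\in C_c^\infty(\mathbb R^N),\ u\ge 1 \text{ on } \Omega\Big\}\in[0,\infty],\qquad \inf\emptyset=\infty,$$ let $|\cdot|$ denote Lebesgue measure, and let $B_r$ be the open ball of radius $r$ centred at the origin. For every $S'>0$ there is a constant $c=c(N,p,S')>0$ such that for every $0<S<S'$ and every open set $\Omega\subset\mathbb R^N$ with $|\Omega|=|B_1|$, $$\mathrm{Cap}_p(B_1)\left(1-\frac{|\Omega\setminus B_S|}{|B_1|}\right)^{\frac{N-p}{N}}\le \mathrm{Cap}_p(\Omega\cap B_S)\le \mathrm{Cap}_p(\Omega)-c\left(1-\frac{S}{S'}\right)^p|\Omega\setminus B_{S'}|^{\frac{N-p}{N}}.$$ -/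

import Mathlib

open MeasureTheory
open scoped ENNReal

/-- The `p`-capacity of a set `Ω ⊆ ℝ^N`: the infimum of `∫ |∇u|^p` over all `u ∈ C_c^∞(ℝ^N)` with
`u ≥ 1` on `Ω`. It takes values in `[0, ∞]`, and the infimum over the empty family is `∞`. -/
noncomputable def pCapacity {N : ℕ} (p : ℝ) (Ω : Set (EuclideanSpace ℝ (Fin N))) : ℝ≥0∞ :=
  ⨅ (u : EuclideanSpace ℝ (Fin N) → ℝ) (_ : ContDiff ℝ ((⊤ : ℕ∞) : WithTop ℕ∞) u)
    (_ : HasCompactSupport u) (_ : ∀ x ∈ Ω, 1 ≤ u x),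
    ∫⁻ x, ENNReal.ofReal (‖gradient u x‖ ^ p)

/-!
The two inequalities rest on the potential `z x = (S / ‖x‖) ^ a`, `a = (N - p) / (p - 1)`, of the ball
`B_S`, whose flux `‖∇z‖ ^ (p - 2) ∇z` is a multiple of the divergence free field `‖x‖ ^ (-N) • x`.

The left inequality is the sharp isocapacitary inequality for `Ω ∩ B_S`
(`ballCapacity_mul_rpow_le_lintegral`) together with the bound for the capacity of the unit ball which
truncations of its potential provide (`pCapacity_ball_le`). The isocapacitary inequality is proved
without rearranging functions. The Brunn–Minkowski inequality, derived from that of Prékopa and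
Leindler, bounds the growth of the superlevel sets of `u` under dilation, and this yields the coarea
inequality with the perimeter of `{t ≤ u}` replaced by that of the ball of the same volume, for all
weights depending on the level (`lintegral_mul_ballPerimeter_le`). Young's inequality
`‖∇u‖ ^ p ≥ p l ^ (p - 1) ‖∇u‖ - (p - 1) l ^ p`, with `l` the slope of the potential at the radius
which corresponds to the volume of the superlevel set through the point, reduces the claim to this
inequality and to an explicit integral.

For the right inequality let `u` be admissible for `Ω`, and truncated at one. The minimum of `u` and
`z` is admissible for `Ω ∩ B_S`. Because `z` is `p`-harmonic off the ball, the energy saved is the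
integral over `{u > z}` of the convexity defect
`‖∇u‖ ^ p - ‖∇z‖ ^ p - p ‖∇z‖ ^ (p - 2) ⟪∇z, ∇u - ∇z⟫`, which is nonnegative but, when `p < 2`, too small
to control `‖∇(u - z)‖ ^ p`. The set `{u > z}` contains the set where `u` exceeds the larger barrier
`1 - θ (1 - z)`, and testing `p`-harmonicity once more with the excess of `u` over this barrier turns
the defect into `‖∇u‖ ^ p + (p - 1 - p θ) ‖∇z‖ ^ p` there. For `θ < (p - 1) / p` this dominates the energy
of the excess (`rpow_norm_add_le_of_barrier`). On `Ω \ B_{S'}` the excess is at least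
`θ (1 - (S / S') ^ a)`, so that the isocapacitary inequality bounds its energy from below. All minima
and positive parts are replaced by smooth approximations, whose parameter tends to zero at the end
(`pCapacity_inter_add_le`).
-/

/-! ### The Prékopa–Leindler and Brunn–Minkowski inequalities -/

/-- Layer cake formula for `ℝ≥0∞`-valued functions. -/
theorem lintegral_eq_lintegral_meas_ofReal_lt {α : Type*} [MeasurableSpace α] {μ : Measure α}
    [SFinite μ] {f : α → ℝ≥0∞} (hf : Measurable f) :
    ∫⁻ x, f x ∂μ = ∫⁻ s in Set.Ioi (0 : ℝ), μ {x | ENNReal.ofReal s < f x} := by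
  have hy : ∀ y : ℝ≥0∞, ∫⁻ s in Set.Ioi (0 : ℝ),
      Set.indicator {s : ℝ | ENNReal.ofReal s < y} 1 s = y := by
    intro y
    have hm : MeasurableSet {s : ℝ | ENNReal.ofReal s < y} :=
      measurableSet_lt ENNReal.measurable_ofReal measurable_const
    rw [lintegral_indicator_one hm, Measure.restrict_apply hm]
    by_cases hyt : y = ∞
    · subst hyt
      have : {s : ℝ | ENNReal.ofReal s < ∞} ∩ Set.Ioi 0 = Set.Ioi (0 : ℝ) := by
        ext s; simp
      rw [this, Real.volume_Ioi]
    · have : {s : ℝ | ENNReal.ofReal s < y} ∩ Set.Ioi 0 = Set.Ioo (0 : ℝ) y.toReal := by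
        ext s
        simp only [Set.mem_inter_iff, Set.mem_ofPred_eq, Set.mem_Ioi, Set.mem_Ioo]
        constructor
        · rintro ⟨h1, h2⟩
          exact ⟨h2, (ENNReal.ofReal_lt_iff_lt_toReal h2.le hyt).1 h1⟩
        · rintro ⟨h1, h2⟩
          exact ⟨(ENNReal.ofReal_lt_iff_lt_toReal h1.le hyt).2 h2, h1⟩
      rw [this, Real.volume_Ioo, sub_zero, ENNReal.ofReal_toReal hyt]
  have hS : MeasurableSet {q : α × ℝ | ENNReal.ofReal q.2 < f q.1} :=
    measurableSet_lt (ENNReal.measurable_ofReal.comp measurable_snd) (hf.comp measurable_fst)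
  calc ∫⁻ x, f x ∂μ
      = ∫⁻ x, (∫⁻ s in Set.Ioi (0 : ℝ),
          Set.indicator {q : α × ℝ | ENNReal.ofReal q.2 < f q.1} 1 (x, s)) ∂μ := by
        refine lintegral_congr fun x => ?_
        rw [← hy (f x)]
        rfl
    _ = ∫⁻ s in Set.Ioi (0 : ℝ), (∫⁻ x,
          Set.indicator {q : α × ℝ | ENNReal.ofReal q.2 < f q.1} 1 (x, s) ∂μ) := by
        refine lintegral_lintegral_swap (Measurable.aemeasurable ?_)
        exact measurable_one.indicator hS
    _ = _ := by
        refine lintegral_congr fun s => ?_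
        have : MeasurableSet {x | ENNReal.ofReal s < f x} :=
          measurableSet_lt measurable_const hf
        rw [← lintegral_indicator_one this]
        rfl

/-- The Brunn–Minkowski inequality on the line, for compact sets: the translates of `A` by the least
element of `B` and of `B` by the greatest element of `A` meet in one point only. -/
theorem IsCompact.volume_add_volume_le {A B C : Set ℝ} (hA : IsCompact A) (hB : IsCompact B)
    (hA0 : A.Nonempty) (hB0 : B.Nonempty) (h : ∀ x ∈ A, ∀ y ∈ B, x + y ∈ C) :
    volume A + volume B ≤ volume C := by
  obtain ⟨a, haA, ha⟩ := hA.exists_isGreatest hA0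
  obtain ⟨b, hbB, hb⟩ := hB.exists_isLeast hB0
  have h1 : volume ((fun x => x + b) '' A) = volume A := by simp
  have h2 : volume ((fun x => a + x) '' B) = volume B := by simp
  have hd : AEDisjoint volume ((fun x => x + b) '' A) ((fun x => a + x) '' B) := by
    refine measure_mono_null (t := {a + b}) ?_ (by simp)
    rintro _ ⟨⟨x, hx, rfl⟩, ⟨y, hy, hxy⟩⟩
    have := ha hx
    have := hb hy
    simp only [Set.mem_singleton_iff] at *
    linarith
  have hm : NullMeasurableSet ((fun x => a + x) '' B) volume :=
    (hB.image (by fun_prop)).measurableSet.nullMeasurableSet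
  rw [← h1, ← h2, ← measure_union₀ hm hd]
  refine measure_mono ?_
  rintro _ (⟨x, hx, rfl⟩ | ⟨y, hy, rfl⟩)
  · exact h x hx b hbB
  · exact h a haA y hy

/-- The Brunn–Minkowski inequality on the line. -/
theorem volume_add_volume_le_of_add_mem {A B C : Set ℝ} (hA : MeasurableSet A)
    (hB : MeasurableSet B) (hA0 : A.Nonempty) (hB0 : B.Nonempty)
    (h : ∀ x ∈ A, ∀ y ∈ B, x + y ∈ C) : volume A + volume B ≤ volume C := by
  obtain ⟨a, ha⟩ := hA0
  obtain ⟨b, hb⟩ := hB0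
  by_cases hA' : volume A = 0
  · rw [hA', zero_add, show volume B = volume ((fun x => a + x) '' B) by simp]
    exact measure_mono (by rintro _ ⟨y, hy, rfl⟩; exact h a ha y hy)
  by_cases hB' : volume B = 0
  · rw [hB', add_zero, show volume A = volume ((fun x => x + b) '' A) by simp]
    exact measure_mono (by rintro _ ⟨y, hy, rfl⟩; exact h y hy b hb)
  by_contra! hlt
  obtain ⟨α, hα, β, hβ, hlt'⟩ := ENNReal.exists_lt_add_of_lt_add hlt hA' hB'
  obtain ⟨K, hKA, hK, hαK⟩ := hA.exists_lt_isCompact hα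
  obtain ⟨L, hLB, hL, hβL⟩ := hB.exists_lt_isCompact hβ
  have := hK.volume_add_volume_le hL (nonempty_of_measure_ne_zero (ne_bot_of_gt hαK))
    (nonempty_of_measure_ne_zero (ne_bot_of_gt hβL)) (fun x hx y hy => h x (hKA hx) y (hLB hy))
  exact absurd (hlt'.trans_le ((add_le_add hαK.le hβL.le).trans this)) (lt_irrefl _)

/-- Weighted arithmetic-geometric mean inequality in `ℝ≥0∞`. -/
theorem ENNReal.rpow_mul_rpow_le_add {t : ℝ} (ht0 : 0 < t) (ht1 : t < 1) (a b : ℝ≥0∞) :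
    a ^ (1 - t) * b ^ t ≤ ENNReal.ofReal (1 - t) * a + ENNReal.ofReal t * b := by
  have h1 : 0 < 1 - t := by linarith
  by_cases ha : a = ∞
  · subst ha
    rw [ENNReal.mul_top (by simpa using h1)]
    simp
  by_cases hb : b = ∞
  · subst hb
    rw [ENNReal.mul_top (by simpa using ht0)]
    simp
  lift a to NNReal using ha
  lift b to NNReal using hb
  have := NNReal.geom_mean_le_arith_mean2_weighted (1 - t).toNNReal t.toNNReal a b
    (by rw [← Real.toNNReal_add h1.le ht0.le]; simp)
  rw [Real.coe_toNNReal _ h1.le, Real.coe_toNNReal _ ht0.le] at this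
  rw [← ENNReal.coe_rpow_of_nonneg _ h1.le, ← ENNReal.coe_rpow_of_nonneg _ ht0.le]
  rw [ENNReal.ofReal, ENNReal.ofReal]
  exact_mod_cast this

/-- The Prékopa–Leindler inequality on the line for bounded functions. -/
theorem prekopa_leindler_real_of_bdd {t : ℝ} (ht0 : 0 < t) (ht1 : t < 1) {f g h : ℝ → ℝ≥0∞}
    (hf : Measurable f) (hg : Measurable g) (hh : Measurable h) (hfb : ⨆ x, f x ≠ ∞)
    (hgb : ⨆ x, g x ≠ ∞) (H : ∀ x y, f x ^ (1 - t) * g y ^ t ≤ h ((1 - t) * x + t * y)) :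
    (∫⁻ x, f x) ^ (1 - t) * (∫⁻ x, g x) ^ t ≤ ∫⁻ x, h x := by
  have h1t : 0 < 1 - t := by linarith
  set M := ⨆ x, f x with hM
  set K := ⨆ x, g x with hK
  by_cases hM0 : M = 0
  · have : ∀ x, f x = 0 := fun x => le_antisymm ((le_iSup f x).trans hM0.le) bot_le
    simp [this, h1t]
  by_cases hK0 : K = 0
  · have : ∀ x, g x = 0 := fun x => le_antisymm ((le_iSup g x).trans hK0.le) bot_le
    simp [this, ht0]
  -- After normalisation all three functions are compared on the levels `s ∈ (0, 1)`.
  set c := M ^ (1 - t) * K ^ t with hc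
  have hc0 : c ≠ 0 := by
    simp only [hc, ne_eq, mul_eq_zero, ENNReal.rpow_eq_zero_iff, not_or]
    refine ⟨⟨?_, ?_⟩, ⟨?_, ?_⟩⟩ <;> simp [hM0, hK0, hfb, hgb]
  have hct : c ≠ ∞ := ENNReal.mul_ne_top (ENNReal.rpow_ne_top_of_nonneg h1t.le hfb)
    (ENNReal.rpow_ne_top_of_nonneg ht0.le hgb)
  have scale : ∀ (k : ℝ → ℝ≥0∞) (m : ℝ≥0∞), Measurable k → m ≠ 0 → m ≠ ∞ →
      ∫⁻ x, k x = m * ∫⁻ s in Set.Ioi (0 : ℝ), volume {x | ENNReal.ofReal s < m⁻¹ * k x} := by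
    intro k m hk hm hm'
    rw [← lintegral_eq_lintegral_meas_ofReal_lt (hk.const_mul _), lintegral_const_mul _ hk,
      ← mul_assoc, ENNReal.mul_inv_cancel hm hm', one_mul]
  have cut : ∀ (k : ℝ → ℝ≥0∞) (m : ℝ≥0∞), m ≠ 0 → m ≠ ∞ → (∀ x, k x ≤ m) →
      ∫⁻ s in Set.Ioi (0 : ℝ), volume {x | ENNReal.ofReal s < m⁻¹ * k x} =
      ∫⁻ s in Set.Ioo (0 : ℝ) 1, volume {x | ENNReal.ofReal s < m⁻¹ * k x} := by
    intro k m hm hm' hk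
    rw [← Set.Ioo_union_Ici_eq_Ioi (zero_lt_one' ℝ), lintegral_union measurableSet_Ici]
    · rw [setLIntegral_congr_fun (g := fun _ => 0) measurableSet_Ici]
      · simp
      · intro s hs
        have : {x | ENNReal.ofReal s < m⁻¹ * k x} = ∅ := by
          ext x
          simp only [Set.mem_ofPred_eq, Set.mem_empty_iff_false, iff_false, not_lt]
          calc m⁻¹ * k x ≤ m⁻¹ * m := by gcongr; exact hk x
            _ = 1 := ENNReal.inv_mul_cancel hm hm'
            _ ≤ ENNReal.ofReal s := by simpa using hs
        simp [this]
    · rw [Set.disjoint_left]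
      intro x hx hx'
      exact absurd hx.2 (not_lt.2 hx')
  have key : ∀ s ∈ Set.Ioo (0 : ℝ) 1,
      ENNReal.ofReal (1 - t) * volume {x | ENNReal.ofReal s < M⁻¹ * f x} +
        ENNReal.ofReal t * volume {x | ENNReal.ofReal s < K⁻¹ * g x} ≤
      volume {x | ENNReal.ofReal s < c⁻¹ * h x} := by
    intro s hs
    have hs1 : ENNReal.ofReal s < 1 := by simpa using hs.2
    have ne : ∀ (k : ℝ → ℝ≥0∞), ⨆ x, k x ≠ 0 → ⨆ x, k x ≠ ∞ →
        {x | ENNReal.ofReal s < (⨆ x, k x)⁻¹ * k x}.Nonempty := by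
      intro k hk0 hkt
      have : ENNReal.ofReal s * ⨆ x, k x < ⨆ x, k x := by
        conv_rhs => rw [← one_mul (⨆ x, k x)]
        exact (ENNReal.mul_lt_mul_iff_left hk0 hkt).2 hs1
      obtain ⟨x, hx⟩ := lt_iSup_iff.1 this
      refine ⟨x, ?_⟩
      rw [Set.mem_ofPred_eq, mul_comm, ← div_eq_mul_inv,
        ENNReal.lt_div_iff_mul_lt (Or.inl hk0) (Or.inl hkt)]
      exact hx
    have sc : ∀ (r : ℝ) (A : Set ℝ), 0 < r →
        ENNReal.ofReal r * volume A = volume ((fun x => r * x) '' A) := by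
      intro r A hr
      have := Measure.addHaar_image_homothety (μ := (volume : Measure ℝ)) 0 r A
      simp only [Module.finrank_self, pow_one, abs_of_pos hr] at this
      rw [← this]
      congr 1
      ext x
      simp [AffineMap.homothety_apply]
    rw [sc _ _ h1t, sc _ _ ht0]
    have mA : MeasurableSet {x | ENNReal.ofReal s < M⁻¹ * f x} :=
      measurableSet_lt measurable_const (hf.const_mul _)
    have mB : MeasurableSet {x | ENNReal.ofReal s < K⁻¹ * g x} :=
      measurableSet_lt measurable_const (hg.const_mul _)
    refine volume_add_volume_le_of_add_mem ?_ ?_ ((ne f hM0 hfb).image _) ((ne g hK0 hgb).image _) ?_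
    · exact ((Homeomorph.mulLeft₀ (1 - t) h1t.ne').measurableEmbedding.measurableSet_image).2 mA
    · exact ((Homeomorph.mulLeft₀ t ht0.ne').measurableEmbedding.measurableSet_image).2 mB
    · rintro _ ⟨x, hx, rfl⟩ _ ⟨y, hy, rfl⟩
      simp only [Set.mem_ofPred_eq] at hx hy ⊢
      have e : ENNReal.ofReal s = ENNReal.ofReal s ^ (1 - t) * ENNReal.ofReal s ^ t := by
        rw [← ENNReal.rpow_add_of_nonneg _ _ h1t.le ht0.le]; simp
      calc ENNReal.ofReal s = ENNReal.ofReal s ^ (1 - t) * ENNReal.ofReal s ^ t := e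
        _ < (M⁻¹ * f x) ^ (1 - t) * (K⁻¹ * g y) ^ t :=
            ENNReal.mul_lt_mul (ENNReal.rpow_lt_rpow hx h1t) (ENNReal.rpow_lt_rpow hy ht0)
        _ = c⁻¹ * (f x ^ (1 - t) * g y ^ t) := by
            rw [ENNReal.mul_rpow_of_nonneg _ _ h1t.le, ENNReal.mul_rpow_of_nonneg _ _ ht0.le, hc,
              ENNReal.mul_inv (Or.inr (ENNReal.rpow_ne_top_of_nonneg ht0.le hgb))
                (Or.inl (ENNReal.rpow_ne_top_of_nonneg h1t.le hfb)), ENNReal.inv_rpow,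
              ENNReal.inv_rpow]
            ring
        _ ≤ c⁻¹ * h ((1 - t) * x + t * y) := by gcongr; exact H x y
  have fm : ∀ (k : ℝ → ℝ≥0∞), Measurable fun s : ℝ => volume {x | ENNReal.ofReal s < k x} := by
    intro k
    refine Antitone.measurable fun s s' hs => measure_mono fun x hx => ?_
    exact lt_of_le_of_lt (ENNReal.ofReal_le_ofReal hs) hx
  have main : c * (ENNReal.ofReal (1 - t) * (M⁻¹ * ∫⁻ x, f x) +
      ENNReal.ofReal t * (K⁻¹ * ∫⁻ x, g x)) ≤ ∫⁻ x, h x := by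
    rw [scale h c hh hc0 hct]
    gcongr
    rw [scale f M hf hM0 hfb, scale g K hg hK0 hgb, ← mul_assoc M⁻¹,
      ENNReal.inv_mul_cancel hM0 hfb, one_mul, ← mul_assoc K⁻¹, ENNReal.inv_mul_cancel hK0 hgb,
      one_mul, cut f M hM0 hfb (le_iSup f), cut g K hK0 hgb (le_iSup g),
      ← lintegral_const_mul _ (fm _), ← lintegral_const_mul _ (fm _),
      ← lintegral_add_left ((fm _).const_mul _)]
    exact (setLIntegral_mono' measurableSet_Ioo key).trans
      (lintegral_mono_set Set.Ioo_subset_Ioi_self)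
  refine le_trans ?_ main
  refine le_trans (le_of_eq ?_) (mul_le_mul_right (ENNReal.rpow_mul_rpow_le_add ht0 ht1 _ _) c)
  rw [ENNReal.mul_rpow_of_nonneg _ _ h1t.le, ENNReal.mul_rpow_of_nonneg _ _ ht0.le,
    ENNReal.inv_rpow, ENNReal.inv_rpow, hc]
  have e1 := ENNReal.mul_inv_cancel (a := M ^ (1 - t))
    (by simp [ENNReal.rpow_eq_zero_iff, hM0, hfb]) (ENNReal.rpow_ne_top_of_nonneg h1t.le hfb)
  have e2 := ENNReal.mul_inv_cancel (a := K ^ t)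
    (by simp [ENNReal.rpow_eq_zero_iff, hK0, hgb]) (ENNReal.rpow_ne_top_of_nonneg ht0.le hgb)
  calc (∫⁻ x, f x) ^ (1 - t) * (∫⁻ x, g x) ^ t
      = (M ^ (1 - t) * (M ^ (1 - t))⁻¹) * (K ^ t * (K ^ t)⁻¹) *
          ((∫⁻ x, f x) ^ (1 - t) * (∫⁻ x, g x) ^ t) := by rw [e1, e2]; simp
    _ = _ := by ring

/-- The Prékopa–Leindler inequality on the line. -/
theorem prekopa_leindler_real {t : ℝ} (ht0 : 0 < t) (ht1 : t < 1) {f g h : ℝ → ℝ≥0∞}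
    (hf : Measurable f) (hg : Measurable g) (hh : Measurable h)
    (H : ∀ x y, f x ^ (1 - t) * g y ^ t ≤ h ((1 - t) * x + t * y)) :
    (∫⁻ x, f x) ^ (1 - t) * (∫⁻ x, g x) ^ t ≤ ∫⁻ x, h x := by
  have h1t : 0 < 1 - t := by linarith
  have hn : ∀ n : ℕ, (∫⁻ x, min (f x) n) ^ (1 - t) * (∫⁻ x, min (g x) n) ^ t ≤ ∫⁻ x, h x := by
    intro n
    refine prekopa_leindler_real_of_bdd ht0 ht1 (hf.min measurable_const)
      (hg.min measurable_const) hh ?_ ?_ ?_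
    · exact ne_top_of_le_ne_top (ENNReal.natCast_ne_top n) (iSup_le fun x => min_le_right _ _)
    · exact ne_top_of_le_ne_top (ENNReal.natCast_ne_top n) (iSup_le fun x => min_le_right _ _)
    · intro x y
      refine le_trans ?_ (H x y)
      gcongr <;> exact min_le_left _ _
  have lim : ∀ k : ℝ → ℝ≥0∞, Measurable k →
      Filter.Tendsto (fun n : ℕ => ∫⁻ x, min (k x) n) Filter.atTop (nhds (∫⁻ x, k x)) := by
    intro k hk
    refine lintegral_tendsto_of_tendsto_of_monotone
      (fun n => (hk.min measurable_const).aemeasurable) ?_ ?_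
    · refine Filter.Eventually.of_forall fun x m n hmn => ?_
      exact min_le_min le_rfl (by exact_mod_cast hmn)
    · refine Filter.Eventually.of_forall fun x => ?_
      have := (tendsto_const_nhds (x := k x) (f := Filter.atTop (α := ℕ))).min
        ENNReal.tendsto_nat_nhds_top
      simpa using this
  by_cases hf0 : ∫⁻ x, f x = 0
  · simp [hf0, h1t]
  by_cases hg0 : ∫⁻ x, g x = 0
  · simp [hg0, ht0]
  refine le_of_tendsto (ENNReal.Tendsto.mul
    (((ENNReal.continuous_rpow_const).tendsto _).comp (lim f hf)) (Or.inl ?_)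
    (((ENNReal.continuous_rpow_const).tendsto _).comp (lim g hg)) (Or.inl ?_))
    (Filter.Eventually.of_forall hn)
  · simp [ENNReal.rpow_eq_zero_iff, hf0, h1t, not_lt.2 h1t.le]
  · simp [ENNReal.rpow_eq_zero_iff, hg0, ht0, not_lt.2 ht0.le]

/-- The Prékopa–Leindler inequality on `ℝⁿ`, by induction on the dimension: the marginals of `f`,
`g`, `h` in the first coordinate satisfy the hypothesis of the one-dimensional inequality. -/
theorem prekopa_leindler_pi {t : ℝ} (ht0 : 0 < t) (ht1 : t < 1) (n : ℕ) :
    ∀ {f g h : (Fin n → ℝ) → ℝ≥0∞}, Measurable f → Measurable g → Measurable h →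
    (∀ x y, f x ^ (1 - t) * g y ^ t ≤ h ((1 - t) • x + t • y)) →
    (∫⁻ x, f x) ^ (1 - t) * (∫⁻ x, g x) ^ t ≤ ∫⁻ x, h x := by
  induction n with
  | zero =>
    intro f g h hf hg hh H
    have h0 := H default default
    rw [Subsingleton.elim ((1 - t) • (default : Fin 0 → ℝ) + t • default) default] at h0
    have h1 : (volume : Measure (Fin 0 → ℝ)) Set.univ = 1 := by simp [volume_pi]
    rw [lintegral_unique, lintegral_unique, lintegral_unique, h1, mul_one, mul_one, mul_one]
    convert h0
  | succ n ih =>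
    intro f g h hf hg hh H
    set e := MeasurableEquiv.piFinSuccAbove (fun _ : Fin (n + 1) => ℝ) 0 with he
    have mp : MeasurePreserving e.symm :=
      (volume_preserving_piFinSuccAbove (fun _ : Fin (n + 1) => ℝ) 0).symm _
    have split : ∀ k : (Fin (n + 1) → ℝ) → ℝ≥0∞, Measurable k →
        ∫⁻ x, k x = ∫⁻ a : ℝ, ∫⁻ x : Fin n → ℝ, k (e.symm (a, x)) := by
      intro k hk
      rw [← mp.lintegral_comp hk, Measure.volume_eq_prod,
        lintegral_prod (fun q => k (e.symm q)) (hk.comp e.symm.measurable).aemeasurable]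
    have ms : ∀ k : (Fin (n + 1) → ℝ) → ℝ≥0∞, Measurable k → ∀ a,
        Measurable fun x : Fin n → ℝ => k (e.symm (a, x)) := fun k hk a =>
      hk.comp (e.symm.measurable.comp measurable_prodMk_left)
    have mi : ∀ k : (Fin (n + 1) → ℝ) → ℝ≥0∞, Measurable k →
        Measurable fun a : ℝ => ∫⁻ x : Fin n → ℝ, k (e.symm (a, x)) := fun k hk =>
      (hk.comp e.symm.measurable).lintegral_prod_right'
    rw [split f hf, split g hg, split h hh]
    refine prekopa_leindler_real ht0 ht1 (mi f hf) (mi g hg) (mi h hh) fun a b => ?_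
    refine ih (ms f hf a) (ms g hg b) (ms h hh _) fun x y => ?_
    refine (H _ _).trans (le_of_eq ?_)
    congr 1
    ext i
    refine Fin.cases ?_ (fun i => ?_) i <;>
      simp [he, MeasurableEquiv.piFinSuccAbove, Fin.insertNthEquiv]

/-- The multiplicative form of the Brunn–Minkowski inequality for compact sets. -/
theorem brunn_minkowski_rpow {n : ℕ} {t : ℝ} (ht0 : 0 < t) (ht1 : t < 1)
    {A B C : Set (EuclideanSpace ℝ (Fin n))} (hA : IsCompact A) (hB : IsCompact B)
    (hC : IsCompact C) (h : ∀ x ∈ A, ∀ y ∈ B, (1 - t) • x + t • y ∈ C) :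
    volume A ^ (1 - t) * volume B ^ t ≤ volume C := by
  have h1t : 0 < 1 - t := by linarith
  have mp := (PiLp.volume_preserving_ofLp (Fin n)).symm (MeasurableEquiv.toLp 2 (Fin n → ℝ)).symm
  have eq : ∀ S : Set (EuclideanSpace ℝ (Fin n)), MeasurableSet S →
      volume S = ∫⁻ x : Fin n → ℝ, S.indicator 1 (WithLp.toLp 2 x) := by
    intro S hS
    rw [← lintegral_indicator_one hS]
    exact (mp.lintegral_comp (measurable_one.indicator hS)).symm
  have me : ∀ S : Set (EuclideanSpace ℝ (Fin n)), MeasurableSet S →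
      Measurable fun x : Fin n → ℝ => S.indicator (1 : EuclideanSpace ℝ (Fin n) → ℝ≥0∞) (WithLp.toLp 2 x) :=
    fun S hS => (measurable_one.indicator hS).comp mp.measurable
  rw [eq A hA.measurableSet, eq B hB.measurableSet, eq C hC.measurableSet]
  refine prekopa_leindler_pi ht0 ht1 n (me A hA.measurableSet) (me B hB.measurableSet)
    (me C hC.measurableSet) fun x y => ?_
  by_cases hx : WithLp.toLp 2 x ∈ A
  · by_cases hy : WithLp.toLp 2 y ∈ B
    · have := h _ hx _ hy
      simp [hx, hy, this]
    · simp [hy, ht0]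
  · simp [hx, h1t]

/-- The Brunn–Minkowski inequality for a compact set and a ball, applied to the rescaled sets
`(1 - t)⁻¹ K` and `t⁻¹ B` for which the multiplicative form is an equality of radii. -/
theorem brunn_minkowski_closedBall {n : ℕ} (hn : n ≠ 0) {K : Set (EuclideanSpace ℝ (Fin n))}
    (hK : IsCompact K) (hK0 : 0 < volume.real K) {h : ℝ} (hh : 0 < h) :
    (volume.real K ^ (1 / n : ℝ) +
        volume.real (Metric.ball (0 : EuclideanSpace ℝ (Fin n)) 1) ^ (1 / n : ℝ) * h) ^ n ≤
      volume.real (Metric.cthickening h K) := by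
  have hn' : (n : ℝ) ≠ 0 := by exact_mod_cast hn
  set m := volume.real K with hm
  set ω := volume.real (Metric.ball (0 : EuclideanSpace ℝ (Fin n)) 1) with hω
  have hω0 : 0 < ω :=
    ENNReal.toReal_pos (Metric.measure_ball_pos _ _ one_pos).ne' measure_ball_lt_top.ne
  set a := m ^ (1 / n : ℝ) with ha
  set b := ω ^ (1 / n : ℝ) * h with hb
  have ha0 : 0 < a := Real.rpow_pos_of_pos hK0 _
  have hb0 : 0 < b := mul_pos (Real.rpow_pos_of_pos hω0 _) hh
  have han : a ^ n = m := by
    rw [ha, ← Real.rpow_natCast, ← Real.rpow_mul hK0.le, one_div_mul_cancel hn', Real.rpow_one]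
  have hbn : b ^ n = ω * h ^ n := by
    rw [hb, mul_pow, ← Real.rpow_natCast, ← Real.rpow_mul hω0.le, one_div_mul_cancel hn',
      Real.rpow_one]
  have hab : 0 < a + b := by positivity
  set t := b / (a + b) with ht
  have ht0 : 0 < t := by positivity
  have h1t : 1 - t = a / (a + b) := by rw [ht]; field_simp; ring
  have h1t0 : 0 < 1 - t := by rw [h1t]; positivity
  have ht1 : t < 1 := by linarith
  have hcomp : IsCompact (Metric.cthickening h K) := hK.cthickening
  have hball : volume.real (Metric.closedBall (0 : EuclideanSpace ℝ (Fin n)) h) = ω * h ^ n := by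
    rw [Measure.real, Measure.addHaar_closedBall _ _ hh.le, ENNReal.toReal_mul,
      ENNReal.toReal_ofReal (by positivity), finrank_euclideanSpace_fin, hω, Measure.real, mul_comm]
  have key := brunn_minkowski_rpow ht0 ht1 (hK.smul (1 - t)⁻¹)
    ((isCompact_closedBall (0 : EuclideanSpace ℝ (Fin n)) h).smul t⁻¹) hcomp (by
      rintro _ ⟨x, hx, rfl⟩ _ ⟨y, hy, rfl⟩
      simp only [smul_smul, mul_inv_cancel₀ h1t0.ne', mul_inv_cancel₀ ht0.ne', one_smul]
      refine Metric.mem_cthickening_of_dist_le _ x _ _ hx ?_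
      simpa using hy)
  have key' := ENNReal.toReal_mono hcomp.measure_lt_top.ne key
  rw [ENNReal.toReal_mul, ← ENNReal.toReal_rpow, ← ENNReal.toReal_rpow] at key'
  simp only [Measure.addHaar_smul, finrank_euclideanSpace_fin, ENNReal.toReal_mul] at key'
  rw [ENNReal.toReal_ofReal (abs_nonneg _), ENNReal.toReal_ofReal (abs_nonneg _),
    abs_of_pos (by positivity), abs_of_pos (by positivity)] at key'
  change ((1 - t)⁻¹ ^ n * m) ^ (1 - t) *
    (t⁻¹ ^ n * volume.real (Metric.closedBall (0 : EuclideanSpace ℝ (Fin n)) h)) ^ t ≤ _ at key'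
  rw [hball, ← hbn, ← han, ← mul_pow, ← mul_pow,
    show (1 - t)⁻¹ * a = a + b by rw [h1t]; field_simp,
    show t⁻¹ * b = a + b by rw [ht]; field_simp, ← Real.rpow_add (by positivity)] at key'
  simpa [Measure.real] using key'

/-- The perimeter of a ball of volume `m` in `ℝⁿ`. -/
noncomputable def ballPerimeter (n : ℕ) (m : ℝ) : ℝ :=
  n * volume.real (Metric.ball (0 : EuclideanSpace ℝ (Fin n)) 1) ^ (1 / n : ℝ) *
    m ^ ((n - 1) / n : ℝ)

theorem ballPerimeter_nonneg (n : ℕ) {m : ℝ} (hm : 0 ≤ m) : 0 ≤ ballPerimeter n m := by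
  unfold ballPerimeter; positivity

/-- First order form of the Brunn–Minkowski inequality: the perimeter of the ball of volume `|K|` is
a lower bound for the growth rate of the volume of the neighbourhoods of `K`. -/
theorem volume_add_mul_le_volume_cthickening {n : ℕ} (hn : 2 ≤ n)
    {K : Set (EuclideanSpace ℝ (Fin n))} (hK : IsCompact K) {h : ℝ} (hh : 0 < h) :
    volume.real K + h * ballPerimeter n (volume.real K) ≤
      volume.real (Metric.cthickening h K) := by
  unfold ballPerimeter
  have hn2 : (2 : ℝ) ≤ n := by exact_mod_cast hn
  rcases (measureReal_nonneg (μ := volume) (s := K)).eq_or_lt with h0 | h0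
  · rw [← h0, Real.zero_rpow (div_ne_zero (by linarith) (by linarith))]
    simp [measureReal_nonneg]
  refine le_trans ?_ (brunn_minkowski_closedBall (by omega) hK h0 hh)
  set m := volume.real K with hm
  set ω := volume.real (Metric.ball (0 : EuclideanSpace ℝ (Fin n)) 1) with hω
  have ha0 : 0 < m ^ (1 / n : ℝ) := Real.rpow_pos_of_pos h0 _
  have hb0 : 0 ≤ ω ^ (1 / n : ℝ) := by positivity
  have han : (m ^ (1 / n : ℝ)) ^ n = m := by
    rw [← Real.rpow_natCast, ← Real.rpow_mul h0.le, one_div_mul_cancel (by linarith),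
      Real.rpow_one]
  have han1 : m ^ ((n - 1) / n : ℝ) = (m ^ (1 / n : ℝ)) ^ (n - 1) := by
    rw [← Real.rpow_natCast, ← Real.rpow_mul h0.le, Nat.cast_sub (by omega)]
    congr 1
    push_cast
    ring
  set a := m ^ (1 / n : ℝ) with ha
  set b := ω ^ (1 / n : ℝ) with hb
  rw [han1]
  have bern := one_add_mul_le_pow (a := b * h / a)
    (by have : 0 ≤ b * h / a := by positivity
        linarith) n
  have hp : a ^ n = a ^ (n - 1) * a := by rw [← pow_succ]; congr 1; omega
  calc m + h * (n * b * a ^ (n - 1)) = a ^ n * (1 + n * (b * h / a)) := by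
        rw [mul_add, mul_one, han, ← han, hp]; field_simp
    _ ≤ a ^ n * (1 + b * h / a) ^ n := by gcongr
    _ = (a + b * h) ^ n := by rw [← mul_pow]; congr 1; field_simp

/-! ### The coarea inequality combined with the isoperimetric inequality -/

/-- Comparison of finite measures on the line through half-open intervals: the difference of the two
distribution functions defines a Stieltjes measure. -/
theorem MeasureTheory.Measure.le_of_Ioc_le {μ ν : Measure ℝ} [IsFiniteMeasure μ]
    [IsFiniteMeasure ν] (h : ∀ a b, a < b → μ (Set.Ioc a b) ≤ ν (Set.Ioc a b)) : μ ≤ ν := by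
  have dec : ∀ (ρ : Measure ℝ) [IsFiniteMeasure ρ] (a b : ℝ), a ≤ b →
      ρ.real (Set.Iic b) = ρ.real (Set.Iic a) + ρ.real (Set.Ioc a b) := by
    intro ρ _ a b hab
    rw [← measureReal_union (by
      rw [Set.disjoint_left]; exact fun x hx hx' => absurd hx'.1 (not_lt.2 hx)) measurableSet_Ioc,
      Set.Iic_union_Ioc_eq_Iic hab]
  have rc : ∀ (ρ : Measure ℝ) [IsFiniteMeasure ρ] (x : ℝ),
      ContinuousWithinAt (fun x => ρ.real (Set.Iic x)) (Set.Ici x) x := by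
    intro ρ _ x
    rw [← continuousWithinAt_Ioi_iff_Ici]
    have := tendsto_measure_biInter_gt (μ := ρ) (s := fun r => Set.Iic r) (a := x)
      (fun r _ => measurableSet_Iic.nullMeasurableSet) (fun i j _ hij => Set.Iic_subset_Iic.2 hij)
      ⟨x + 1, by simp, measure_ne_top _ _⟩
    have e : ⋂ r > x, Set.Iic r = Set.Iic x := by
      ext y
      simp only [Set.mem_iInter, Set.mem_Iic]
      exact ⟨fun hy => le_of_forall_gt_imp_ge_of_dense hy, fun hy r hr => hy.trans hr.le⟩
    rw [e] at this
    exact (ENNReal.tendsto_toReal (measure_ne_top _ _)).comp this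
  let F : StieltjesFunction ℝ :=
    { toFun := fun x => ν.real (Set.Iic x) - μ.real (Set.Iic x)
      mono' := by
        intro a b hab
        rcases hab.eq_or_lt with rfl | hab'
        · exact le_rfl
        have := ENNReal.toReal_mono (measure_ne_top _ _) (h a b hab')
        simp only [dec ν a b hab, dec μ a b hab]
        simp only [Measure.real] at *
        linarith
      right_continuous' := fun x => (rc ν x).sub (rc μ x) }
  have : ν = F.measure + μ := by
    refine Measure.ext_of_Ioc _ _ fun a b hab => ?_
    have hF : F.measure (Set.Ioc a b) =
        ENNReal.ofReal (ν.real (Set.Ioc a b) - μ.real (Set.Ioc a b)) := by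
      rw [StieltjesFunction.measure_Ioc]
      congr 1
      change (ν.real (Set.Iic b) - μ.real (Set.Iic b)) - (ν.real (Set.Iic a) - μ.real (Set.Iic a)) = _
      rw [dec ν a b hab.le, dec μ a b hab.le]
      ring
    rw [Measure.add_apply, hF, ENNReal.ofReal_sub _ measureReal_nonneg, ofReal_measureReal,
      ofReal_measureReal, tsub_add_cancel_of_le (h a b hab)]
  rw [this]
  exact Measure.le_add_left le_rfl

/-- A compactly supported `C¹` function is uniformly differentiable: its increments over small balls
are controlled by the norm of the derivative at the centre. -/
theorem exists_forall_le_add_mul_of_contDiff {E : Type*} [NormedAddCommGroup E] [NormedSpace ℝ E]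
    {u : E → ℝ} (hu : ContDiff ℝ 1 u) (hc : HasCompactSupport u) {ε : ℝ} (hε : 0 < ε) :
    ∃ δ > 0, ∀ h, 0 ≤ h → h < δ → ∀ x y, dist x y ≤ h →
      u y ≤ u x + h * (‖fderiv ℝ u x‖ + ε) := by
  have huc : UniformContinuous (fderiv ℝ u) :=
    (hc.fderiv ℝ).uniformContinuous_of_continuous (hu.continuous_fderiv one_ne_zero)
  obtain ⟨δ, hδ, H⟩ := Metric.uniformContinuous_iff.1 huc ε hε
  refine ⟨δ, hδ, fun h h0 hh x y hxy => ?_⟩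
  have := (convex_closedBall x h).norm_image_sub_le_of_norm_fderiv_le (𝕜 := ℝ) (f := u)
    (C := ‖fderiv ℝ u x‖ + ε) (x := x) (y := y)
    (fun z _ => (hu.differentiable one_ne_zero).differentiableAt) (fun z hz => by
      have h1 := H (lt_of_le_of_lt (Metric.mem_closedBall.1 hz) hh)
      rw [dist_eq_norm] at h1
      have := norm_le_norm_add_norm_sub (fderiv ℝ u x) (fderiv ℝ u z)
      rw [norm_sub_rev] at h1
      linarith)
    (Metric.mem_closedBall_self h0) (Metric.mem_closedBall'.2 hxy)
  have h2 : ‖y - x‖ ≤ h := by rwa [← dist_eq_norm, dist_comm]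
  have h3 : (‖fderiv ℝ u x‖ + ε) * ‖y - x‖ ≤ h * (‖fderiv ℝ u x‖ + ε) := by
    rw [mul_comm]; gcongr
  have := le_abs_self (u y - u x)
  rw [← Real.norm_eq_abs] at this
  linarith

section

variable {n : ℕ} {u : EuclideanSpace ℝ (Fin n) → ℝ}

theorem HasCompactSupport.isCompact_superlevel (hu : Continuous u) (hc : HasCompactSupport u)
    {t : ℝ} (ht : 0 < t) : IsCompact {x | t ≤ u x} := by
  refine hc.isCompact.of_isClosed_subset (isClosed_le continuous_const hu) fun x hx => ?_
  exact subset_tsupport _ (ht.trans_le hx).ne'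

theorem measurable_volume_superlevel (u : EuclideanSpace ℝ (Fin n) → ℝ) :
    Measurable fun t : ℝ => volume.real {x | t ≤ u x} := by
  have : Antitone fun t : ℝ => volume {x | t ≤ u x} :=
    fun s t hst => measure_mono fun x hx => le_trans hst hx
  exact this.measurable.ennreal_toReal

/-- For small `h`, the `h`-neighbourhood of `{t ≤ u}` lies in `{t ≤ u + h (‖∇u‖ + ε)}`. Integrating the
resulting bound for the growth of the superlevel sets over the levels `t ∈ (α, β]` gives, by Tonelli's
theorem, the integral of the increments `h (‖∇u‖ + ε)`. -/
theorem setLIntegral_ballPerimeter_le_add (hn : 2 ≤ n) (hu : ContDiff ℝ 1 u)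
    (hc : HasCompactSupport u) {α β ε : ℝ} (hα : 0 < α) (hε : 0 < ε) :
    ∫⁻ t in Set.Ioc α β, ENNReal.ofReal (ballPerimeter n (volume.real {x | t ≤ u x})) ≤
      ∫⁻ x in {x | x ∈ Metric.cthickening 1 (tsupport u) ∧ α - ε ≤ u x ∧ u x ≤ β},
        ENNReal.ofReal (‖fderiv ℝ u x‖ + ε) := by
  obtain ⟨δ, hδ, H⟩ := exists_forall_le_add_mul_of_contDiff hu hc hε
  have hDc : Continuous fun x => ‖fderiv ℝ u x‖ := (hu.continuous_fderiv one_ne_zero).norm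
  obtain ⟨L, hL⟩ := (hu.continuous_fderiv one_ne_zero).bounded_above_of_compact_support
    (hc.fderiv ℝ)
  have hL0 : 0 ≤ L := (norm_nonneg _).trans (hL 0)
  -- The last bound on `h` makes all increments at most `ε`, so that only points with `α - ε ≤ u` matter.
  obtain ⟨h, hh0, hh⟩ : ∃ h, 0 < h ∧ h < min (min δ 1) (ε / (L + ε)) :=
    exists_between (by positivity)
  simp only [lt_min_iff] at hh
  obtain ⟨⟨hhδ, hh1⟩, hhL⟩ := hh
  rw [lt_div_iff₀ (by positivity)] at hhL
  set K1 := Metric.cthickening 1 (tsupport u) with hK1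
  have hK1c : IsCompact K1 := hc.isCompact.cthickening
  set F := fun x => u x + h * (‖fderiv ℝ u x‖ + ε) with hF
  have hFc : Continuous F := by have := hu.continuous; fun_prop
  have slice : ∀ t ∈ Set.Ioc α β,
      ENNReal.ofReal h * ENNReal.ofReal (ballPerimeter n (volume.real {x | t ≤ u x})) ≤
        volume.restrict K1 {x | u x < t ∧ t ≤ F x} := by
    intro t ht
    have ht0 : 0 < t := hα.trans ht.1
    have hKt := hc.isCompact_superlevel hu.continuous ht0
    have bm := volume_add_mul_le_volume_cthickening hn hKt hh0
    have sub : Metric.cthickening h {x | t ≤ u x} ⊆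
        {x | t ≤ u x} ∪ ({x | u x < t ∧ t ≤ F x} ∩ K1) := by
      intro x hx
      by_cases hxt : t ≤ u x
      · exact Or.inl hxt
      refine Or.inr ⟨⟨not_le.1 hxt, ?_⟩, ?_⟩
      · rw [hKt.cthickening_eq_biUnion_closedBall hh0.le] at hx
        simp only [Set.mem_iUnion] at hx
        obtain ⟨y, hy, hxy⟩ := hx
        exact le_trans (α := ℝ) hy (H h hh0.le hhδ x y hxy)
      · refine Metric.cthickening_mono hh1.le _ (Metric.cthickening_subset_of_subset _ ?_ hx)
        intro y hy
        exact subset_tsupport _ (ht0.trans_le hy).ne'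
    have hsm : MeasurableSet {x | u x < t ∧ t ≤ F x} :=
      (measurableSet_lt hu.continuous.measurable measurable_const).inter
        (measurableSet_le measurable_const hFc.measurable)
    have h3 := ENNReal.ofReal_le_ofReal bm
    rw [ofReal_measureReal hKt.cthickening.measure_lt_top.ne] at h3
    replace h3 := h3.trans ((measure_mono sub).trans (measure_union_le _ _))
    rw [ENNReal.ofReal_add measureReal_nonneg
      (mul_nonneg hh0.le (ballPerimeter_nonneg n measureReal_nonneg)),
      ofReal_measureReal hKt.measure_lt_top.ne] at h3
    rw [Measure.restrict_apply hsm, ← ENNReal.ofReal_mul hh0.le]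
    exact (ENNReal.add_le_add_iff_left hKt.measure_lt_top.ne).1 h3
  have hS : MeasurableSet {q : ℝ × EuclideanSpace ℝ (Fin n) | u q.2 < q.1 ∧ q.1 ≤ F q.2} :=
    (measurableSet_lt (hu.continuous.measurable.comp measurable_snd) measurable_fst).inter
      (measurableSet_le measurable_fst (hFc.measurable.comp measurable_snd))
  have hh' : ENNReal.ofReal h ≠ 0 := by simpa using hh0
  rw [← ENNReal.mul_le_mul_iff_right hh' ENNReal.ofReal_ne_top]
  set A := {x | x ∈ K1 ∧ α - ε ≤ u x ∧ u x ≤ β} with hA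
  have hAm : MeasurableSet {x | α - ε ≤ u x ∧ u x ≤ β} :=
    (measurableSet_le measurable_const hu.continuous.measurable).inter
      (measurableSet_le hu.continuous.measurable measurable_const)
  have hAm' : MeasurableSet A := hK1c.measurableSet.inter hAm
  calc ENNReal.ofReal h *
        ∫⁻ t in Set.Ioc α β, ENNReal.ofReal (ballPerimeter n (volume.real {x | t ≤ u x}))
      = ∫⁻ t in Set.Ioc α β,
          ENNReal.ofReal h * ENNReal.ofReal (ballPerimeter n (volume.real {x | t ≤ u x})) := by
        rw [lintegral_const_mul' _ _ ENNReal.ofReal_ne_top]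
    _ ≤ ∫⁻ t in Set.Ioc α β, volume.restrict K1 {x | u x < t ∧ t ≤ F x} :=
        setLIntegral_mono' measurableSet_Ioc slice
    _ = ∫⁻ t in Set.Ioc α β, (∫⁻ x in K1, Set.indicator
          {q : ℝ × EuclideanSpace ℝ (Fin n) | u q.2 < q.1 ∧ q.1 ≤ F q.2} 1 (t, x)) := by
        refine lintegral_congr fun t => ?_
        exact (lintegral_indicator_one (measurable_prodMk_left (x := t) hS)).symm
    _ = ∫⁻ x in K1, (∫⁻ t in Set.Ioc α β, Set.indicator
          {q : ℝ × EuclideanSpace ℝ (Fin n) | u q.2 < q.1 ∧ q.1 ≤ F q.2} 1 (t, x)) :=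
        lintegral_lintegral_swap (measurable_one.indicator hS).aemeasurable
    _ = ∫⁻ x in K1, volume (Set.Ioc (u x) (F x) ∩ Set.Ioc α β) := by
        refine lintegral_congr fun x => ?_
        rw [← Measure.restrict_apply measurableSet_Ioc, ← lintegral_indicator_one measurableSet_Ioc]
        rfl
    _ ≤ ∫⁻ x in K1, A.indicator (fun x => ENNReal.ofReal h *
          ENNReal.ofReal (‖fderiv ℝ u x‖ + ε)) x := by
        refine setLIntegral_mono' hK1c.measurableSet fun x hx => ?_
        by_cases hxA : x ∈ A
        · rw [Set.indicator_of_mem hxA, ← ENNReal.ofReal_mul hh0.le]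
          refine (measure_mono Set.inter_subset_left).trans (le_of_eq ?_)
          rw [Real.volume_Ioc, hF]
          congr 1
          ring
        · rw [Set.indicator_of_notMem hxA, nonpos_iff_eq_zero]
          convert measure_empty (μ := (volume : Measure ℝ))
          rw [Set.eq_empty_iff_forall_notMem]
          rintro t ⟨⟨h1, h2⟩, h3, h4⟩
          refine hxA ⟨hx, ?_, by linarith⟩
          have : h * (‖fderiv ℝ u x‖ + ε) ≤ h * (L + ε) := by gcongr; exact hL x
          simp only [hF] at h2
          linarith
    _ = ENNReal.ofReal h * ∫⁻ x in A, ENNReal.ofReal (‖fderiv ℝ u x‖ + ε) := by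
        rw [lintegral_indicator hAm', Measure.restrict_restrict hAm',
          Set.inter_eq_left.2 (fun x hx => hx.1), lintegral_const_mul' _ _ ENNReal.ofReal_ne_top]

/-- The coarea inequality between two levels, with the perimeter of each superlevel set replaced by that
of the ball of the same volume. -/
theorem setLIntegral_ballPerimeter_le (hn : 2 ≤ n) (hu : ContDiff ℝ 1 u)
    (hc : HasCompactSupport u) {α β : ℝ} (hα : 0 < α) :
    ∫⁻ t in Set.Ioc α β, ENNReal.ofReal (ballPerimeter n (volume.real {x | t ≤ u x})) ≤
      ∫⁻ x in {x | α ≤ u x ∧ u x ≤ β}, ENNReal.ofReal ‖fderiv ℝ u x‖ := by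
  have hDc : Continuous fun x => ‖fderiv ℝ u x‖ := (hu.continuous_fderiv one_ne_zero).norm
  set K := Metric.cthickening 1 (tsupport u) with hK
  have hKc : IsCompact K := hc.isCompact.cthickening
  have hi : Integrable (fun x => ‖fderiv ℝ u x‖) :=
    hDc.integrable_of_hasCompactSupport (hc.fderiv ℝ).norm
  set ε : ℕ → ℝ := fun k => 1 / ((k : ℝ) + 1) with hε
  have hε0 : ∀ k, 0 < ε k := fun k => by simp only [hε]; positivity
  have hεl : Filter.Tendsto ε Filter.atTop (nhds 0) := tendsto_one_div_add_atTop_nhds_zero_nat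
  set ν := (volume : Measure (EuclideanSpace ℝ (Fin n))).withDensity
    fun x => ENNReal.ofReal ‖fderiv ℝ u x‖ with hν
  have hνf : IsFiniteMeasure ν :=
    isFiniteMeasure_withDensity_ofReal hi.hasFiniteIntegral
  have hm : ∀ a b : ℝ, MeasurableSet {x | a ≤ u x ∧ u x ≤ b} := fun a b =>
    (measurableSet_le measurable_const hu.continuous.measurable).inter
      (measurableSet_le hu.continuous.measurable measurable_const)
  have bound : ∀ k, ∫⁻ t in Set.Ioc α β,
      ENNReal.ofReal (ballPerimeter n (volume.real {x | t ≤ u x})) ≤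
        ν {x | α - ε k ≤ u x ∧ u x ≤ β} + ENNReal.ofReal (ε k) * volume K := by
    intro k
    refine (setLIntegral_ballPerimeter_le_add hn hu hc hα (hε0 k)).trans ?_
    calc ∫⁻ x in {x | x ∈ K ∧ α - ε k ≤ u x ∧ u x ≤ β}, ENNReal.ofReal (‖fderiv ℝ u x‖ + ε k)
        = (∫⁻ x in {x | x ∈ K ∧ α - ε k ≤ u x ∧ u x ≤ β}, ENNReal.ofReal ‖fderiv ℝ u x‖) +
          ∫⁻ x in {x | x ∈ K ∧ α - ε k ≤ u x ∧ u x ≤ β}, ENNReal.ofReal (ε k) := by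
          rw [← lintegral_add_right _ measurable_const]
          exact lintegral_congr fun x => ENNReal.ofReal_add (norm_nonneg _) (hε0 k).le
      _ ≤ _ := by
          rw [setLIntegral_const, hν, withDensity_apply _ (hm _ _)]
          exact add_le_add (lintegral_mono_set fun x hx => hx.2)
            (mul_le_mul_right (measure_mono fun x hx => hx.1) _)
  have lim1 : Filter.Tendsto (fun k => ν {x | α - ε k ≤ u x ∧ u x ≤ β}) Filter.atTop
      (nhds (ν {x | α ≤ u x ∧ u x ≤ β})) := by
    have := tendsto_measure_iInter_atTop (μ := ν) (s := fun k => {x | α - ε k ≤ u x ∧ u x ≤ β})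
      (fun k => (hm _ _).nullMeasurableSet) (fun i j hij x hx => ⟨?_, hx.2⟩)
      ⟨0, measure_ne_top _ _⟩
    · have e : ⋂ k, {x | α - ε k ≤ u x ∧ u x ≤ β} = {x | α ≤ u x ∧ u x ≤ β} := ?_
      · rwa [e] at this
      ext x
      simp only [Set.mem_iInter, Set.mem_ofPred_eq]
      refine ⟨fun hx => ⟨?_, (hx 0).2⟩, fun hx k => ⟨by linarith [hε0 k], hx.2⟩⟩
      refine le_of_tendsto (f := fun k => α - ε k) (x := Filter.atTop) ?_
        (Filter.Eventually.of_forall fun k => (hx k).1)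
      simpa using tendsto_const_nhds.sub hεl
    · have : ε j ≤ ε i := one_div_le_one_div_of_le (by positivity) (by simpa using hij)
      linarith [hx.1]
  have lim2 : Filter.Tendsto (fun k => ENNReal.ofReal (ε k) * volume K) Filter.atTop (nhds 0) := by
    have := ENNReal.Tendsto.mul_const (b := volume K) (ENNReal.tendsto_ofReal hεl)
      (Or.inr hKc.measure_lt_top.ne)
    simpa using this
  have := ge_of_tendsto' (lim1.add lim2) bound
  rwa [add_zero, hν, withDensity_apply _ (hm _ _)] at this

/-- The weighted form of `setLIntegral_ballPerimeter_le`: that inequality compares two measures on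
intervals, hence on all functions of the level. -/
theorem lintegral_mul_ballPerimeter_le (hn : 2 ≤ n) (hu : ContDiff ℝ 1 u)
    (hc : HasCompactSupport u) {g : ℝ → ℝ≥0∞} (hg : Measurable g) :
    ∫⁻ t in Set.Ioo 0 1, g t * ENNReal.ofReal (ballPerimeter n (volume.real {x | t ≤ u x})) ≤
      ∫⁻ x in {x | 0 < u x ∧ u x < 1}, g (u x) * ENNReal.ofReal ‖fderiv ℝ u x‖ := by
  have hDc : Continuous fun x => ‖fderiv ℝ u x‖ := (hu.continuous_fderiv one_ne_zero).norm
  have hum := hu.continuous.measurable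
  have hi : Integrable (fun x => ‖fderiv ℝ u x‖) :=
    hDc.integrable_of_hasCompactSupport (hc.fderiv ℝ).norm
  have hDm : Measurable fun x => ENNReal.ofReal ‖fderiv ℝ u x‖ := hDc.measurable.ennreal_ofReal
  set ν := (volume : Measure (EuclideanSpace ℝ (Fin n))).withDensity
    fun x => ENNReal.ofReal ‖fderiv ℝ u x‖ with hν
  have hνf : IsFiniteMeasure ν := isFiniteMeasure_withDensity_ofReal hi.hasFiniteIntegral
  set P : ℝ → ℝ≥0∞ := fun t => ENNReal.ofReal (ballPerimeter n (volume.real {x | t ≤ u x})) with hP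
  have hPm : Measurable P := by
    have := measurable_volume_superlevel u
    simp only [hP, ballPerimeter]
    fun_prop
  set μ := (volume : Measure ℝ).withDensity P with hμ
  have closed : ∀ α β, 0 < α → μ (Set.Ioc α β) ≤ ν {x | α ≤ u x ∧ u x ≤ β} := by
    intro α β hα
    have hm : MeasurableSet {x | α ≤ u x ∧ u x ≤ β} :=
      (measurableSet_le measurable_const hum).inter (measurableSet_le hum measurable_const)
    rw [hμ, withDensity_apply _ measurableSet_Ioc, hν, withDensity_apply _ hm]
    exact setLIntegral_ballPerimeter_le hn hu hc hα
  have half : ∀ α β, 0 ≤ α → μ (Set.Ioc α β) ≤ ν.map u (Set.Ioc α β) := by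
    intro α β hα
    have e : Set.Ioc α β = ⋃ k : ℕ, Set.Ioc (α + 1 / ((k : ℝ) + 1)) β := by
      ext t
      simp only [Set.mem_iUnion, Set.mem_Ioc]
      constructor
      · rintro ⟨h1, h2⟩
        obtain ⟨k, hk⟩ := exists_nat_one_div_lt (sub_pos.2 h1)
        exact ⟨k, by linarith, h2⟩
      · rintro ⟨k, h1, h2⟩
        have : 0 < 1 / ((k : ℝ) + 1) := by positivity
        exact ⟨by linarith, h2⟩
    have hmono : Monotone fun k : ℕ => Set.Ioc (α + 1 / ((k : ℝ) + 1)) β := by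
      intro i j hij
      refine Set.Ioc_subset_Ioc_left ?_
      have : 1 / ((j : ℝ) + 1) ≤ 1 / ((i : ℝ) + 1) :=
        one_div_le_one_div_of_le (by positivity) (by simpa using hij)
      linarith
    nth_rewrite 1 [e]
    rw [hmono.measure_iUnion, Measure.map_apply hum measurableSet_Ioc]
    refine iSup_le fun k => ?_
    have hk : 0 < 1 / ((k : ℝ) + 1) := by positivity
    refine (closed _ _ (by linarith)).trans (measure_mono fun x hx => ⟨?_, hx.2⟩)
    have := hx.1
    linarith
  have h1 : μ (Set.Ioc 0 1) ≠ ∞ := ((half 0 1 le_rfl).trans_lt (measure_lt_top _ _)).ne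
  have : IsFiniteMeasure (μ.restrict (Set.Ioc 0 1)) :=
    isFiniteMeasure_restrict.2 h1
  have le : μ.restrict (Set.Ioc 0 1) ≤ (ν.map u).restrict (Set.Ioc 0 1) := by
    refine Measure.le_of_Ioc_le fun a b _ => ?_
    rw [Measure.restrict_apply measurableSet_Ioc, Measure.restrict_apply measurableSet_Ioc,
      Set.Ioc_inter_Ioc]
    exact half _ _ le_sup_right
  have hsub : Set.Ioo (0 : ℝ) 1 ⊆ Set.Ioc 0 1 := Set.Ioo_subset_Ioc_self
  have le' : μ.restrict (Set.Ioo 0 1) ≤ (ν.map u).restrict (Set.Ioo 0 1) := by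
    have := Measure.restrict_mono (s := Set.Ioo 0 1) subset_rfl le
    rwa [Measure.restrict_restrict measurableSet_Ioo, Measure.restrict_restrict measurableSet_Ioo,
      Set.inter_eq_left.2 hsub] at this
  have hS : MeasurableSet {x | 0 < u x ∧ u x < 1} :=
    (measurableSet_lt measurable_const hum).inter (measurableSet_lt hum measurable_const)
  calc ∫⁻ t in Set.Ioo 0 1, g t * P t = ∫⁻ t in Set.Ioo 0 1, g t ∂μ := by
        rw [hμ, setLIntegral_withDensity_eq_setLIntegral_mul _ hPm hg measurableSet_Ioo]
        exact lintegral_congr fun t => mul_comm _ _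
    _ ≤ ∫⁻ t in Set.Ioo 0 1, g t ∂(ν.map u) := lintegral_mono' le' le_rfl
    _ = ∫⁻ x in {x | 0 < u x ∧ u x < 1}, g (u x) ∂ν := by
        rw [setLIntegral_map measurableSet_Ioo hg hum]
        rfl
    _ = _ := by
        refine (setLIntegral_withDensity_eq_setLIntegral_mul _ hDm (hg.comp hum) hS).trans ?_
        exact lintegral_congr fun t => mul_comm _ _

end

/-! ### The isocapacitary inequality -/

section

variable {n : ℕ} {u : EuclideanSpace ℝ (Fin n) → ℝ}

/-- The points whose superlevel set has small volume form a set of small volume: a compact part of that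
set lies in the superlevel set of the point where `u` is least on it. -/
theorem volume_setOf_volume_superlevel_lt_le (hu : Continuous u) (hc : HasCompactSupport u) (q : ℝ) :
    volume {x | 0 < u x ∧ volume.real {y | u x ≤ u y} < q} ≤ ENNReal.ofReal q := by
  have hm : MeasurableSet {x | 0 < u x ∧ volume.real {y | u x ≤ u y} < q} :=
    (measurableSet_lt measurable_const hu.measurable).inter
      (measurableSet_lt ((measurable_volume_superlevel u).comp hu.measurable) measurable_const)
  rw [hm.measure_eq_iSup_isCompact]
  refine iSup₂_le fun K hK => iSup_le fun hKc => ?_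
  rcases K.eq_empty_or_nonempty with rfl | hne
  · simp
  obtain ⟨x, hx, hmin⟩ := hKc.exists_isMinOn hne hu.continuousOn
  have hf : volume {y | u x ≤ u y} ≠ ∞ := (hc.isCompact_superlevel hu (hK hx).1).measure_lt_top.ne
  calc volume K ≤ volume {y | u x ≤ u y} := measure_mono fun y hy => hmin hy
    _ = ENNReal.ofReal (volume.real {y | u x ≤ u y}) := (ofReal_measureReal hf).symm
    _ ≤ ENNReal.ofReal q := ENNReal.ofReal_le_ofReal (hK hx).2.le

/-- Replacing each value of `u` by the volume of its superlevel set transports Lebesgue measure to a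
measure which is at most Lebesgue measure, as far as decreasing powers are concerned. -/
theorem setLIntegral_volume_superlevel_rpow_le (hu : Continuous u) (hc : HasCompactSupport u)
    (hm : 0 < volume.real {x | 1 ≤ u x}) {e : ℝ} (he : 0 < e) :
    ∫⁻ x in {x | 0 < u x ∧ u x < 1}, ENNReal.ofReal (volume.real {y | u x ≤ u y} ^ (-e)) ≤
      ∫⁻ q in Set.Ioi (volume.real {x | 1 ≤ u x}), ENNReal.ofReal (q ^ (-e)) := by
  have hWm : Measurable fun x => volume.real {y | u x ≤ u y} :=
    (measurable_volume_superlevel u).comp hu.measurable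
  have hWe : Measurable fun x => ENNReal.ofReal (volume.real {y | u x ≤ u y} ^ (-e)) := by fun_prop
  have hqe : Measurable fun q : ℝ => ENNReal.ofReal (q ^ (-e)) := by fun_prop
  rw [lintegral_eq_lintegral_meas_ofReal_lt hWe, lintegral_eq_lintegral_meas_ofReal_lt hqe]
  refine setLIntegral_mono' measurableSet_Ioi fun s hs => ?_
  have hs : 0 < s := hs
  set m := volume.real {x | 1 ≤ u x} with hmdef
  have h1 := hc.isCompact_superlevel hu one_pos
  have inv : ∀ w : ℝ, 0 < w → (ENNReal.ofReal s < ENNReal.ofReal (w ^ (-e)) ↔ w < s ^ (-e⁻¹)) := by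
    intro w hw
    rw [ENNReal.ofReal_lt_ofReal_iff (by positivity), ← inv_neg,
      Real.lt_rpow_inv_iff_of_neg hw hs (by linarith)]
  have hA : MeasurableSet {x | 0 < u x ∧ u x < 1} :=
    (measurableSet_lt measurable_const hu.measurable).inter
      (measurableSet_lt hu.measurable measurable_const)
  rw [Measure.restrict_apply' hA, Measure.restrict_apply' measurableSet_Ioi]
  have hWge : ∀ x, u x < 1 → 0 < u x → m ≤ volume.real {y | u x ≤ u y} := fun x hx hx0 =>
    measureReal_mono (fun y hy => hx.le.trans hy) (hc.isCompact_superlevel hu hx0).measure_lt_top.ne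
  have e1 : {q | ENNReal.ofReal s < ENNReal.ofReal (q ^ (-e))} ∩ Set.Ioi m =
      Set.Ioo m (s ^ (-e⁻¹)) := by
    ext q
    simp only [Set.mem_inter_iff, Set.mem_ofPred_eq, Set.mem_Ioi, Set.mem_Ioo]
    exact ⟨fun ⟨h, h'⟩ => ⟨h', (inv q (hm.trans h')).1 h⟩,
      fun ⟨h', h⟩ => ⟨(inv q (hm.trans h')).2 h, h'⟩⟩
  have e2 : {x | ENNReal.ofReal s < ENNReal.ofReal (volume.real {y | u x ≤ u y} ^ (-e))} ∩
      {x | 0 < u x ∧ u x < 1} =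
      {x | (0 < u x ∧ volume.real {y | u x ≤ u y} < s ^ (-e⁻¹)) ∧ u x < 1} := by
    ext x
    simp only [Set.mem_inter_iff, Set.mem_ofPred_eq]
    constructor
    · rintro ⟨h, h0, h1⟩
      exact ⟨⟨h0, (inv _ (hm.trans_le (hWge x h1 h0))).1 h⟩, h1⟩
    · rintro ⟨⟨h0, h⟩, h1⟩
      exact ⟨(inv _ (hm.trans_le (hWge x h1 h0))).2 h, h0, h1⟩
  rw [e1, e2, Real.volume_Ioo]
  rcases le_or_gt (s ^ (-e⁻¹)) m with hle | hlt
  · refine (measure_mono_null (t := ∅) ?_ measure_empty).trans_le bot_le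
    rintro x ⟨⟨h0, h⟩, h1⟩
    exact absurd (h.trans_le hle) (not_lt.2 (hWge x h1 h0))
  · -- The set and `{1 ≤ u}` are disjoint parts of a set of volume at most `s ^ (-1 / e)`.
    have hd : Disjoint {x | (0 < u x ∧ volume.real {y | u x ≤ u y} < s ^ (-e⁻¹)) ∧ u x < 1}
        {x | 1 ≤ u x} := by
      rw [Set.disjoint_left]
      exact fun x hx hx' => absurd hx.2 (not_lt.2 hx')
    have hsub : {x | (0 < u x ∧ volume.real {y | u x ≤ u y} < s ^ (-e⁻¹)) ∧ u x < 1} ∪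
        {x | 1 ≤ u x} ⊆ {x | 0 < u x ∧ volume.real {y | u x ≤ u y} < s ^ (-e⁻¹)} := by
      rintro x (hx | hx)
      · exact hx.1
      · refine ⟨lt_of_lt_of_le one_pos hx, lt_of_le_of_lt ?_ hlt⟩
        exact measureReal_mono (fun y hy => le_trans (α := ℝ) hx hy) h1.measure_lt_top.ne
    have h2 := (measure_mono hsub).trans (volume_setOf_volume_superlevel_lt_le hu hc _)
    rw [measure_union hd h1.measurableSet] at h2
    rw [ENNReal.ofReal_sub _ hm.le, hmdef, ofReal_measureReal h1.measure_lt_top.ne]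
    exact ENNReal.le_sub_of_add_le_right h1.measure_lt_top.ne h2

/-- The `p`-capacity of the unit ball of `ℝⁿ` for `1 < p < n`, in closed form. -/
noncomputable def ballCapacity (n : ℕ) (p : ℝ) : ℝ :=
  n * volume.real (Metric.ball (0 : EuclideanSpace ℝ (Fin n)) 1) * ((n - p) / (p - 1)) ^ (p - 1)

theorem ballCapacity_pos {n : ℕ} {p : ℝ} (hp : 1 < p) (hpn : p < n) : 0 < ballCapacity n p := by
  have hω0 : 0 < volume.real (Metric.ball (0 : EuclideanSpace ℝ (Fin n)) 1) :=
    ENNReal.toReal_pos (Metric.measure_ball_pos _ _ one_pos).ne' measure_ball_lt_top.ne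
  have : 0 < (n - p) / (p - 1) := div_pos (by linarith) (by linarith)
  have : (0 : ℝ) < n := by linarith
  unfold ballCapacity
  positivity

/-- Young's inequality in the form of a tangent line inequality for `x ↦ x ^ p`. -/
theorem Real.mul_rpow_mul_le_rpow_add {p x l : ℝ} (hp : 1 < p) (hx : 0 ≤ x) (hl : 0 ≤ l) :
    p * l ^ (p - 1) * x ≤ x ^ p + (p - 1) * l ^ p := by
  have hpq : p.HolderConjugate (p / (p - 1)) := Real.HolderConjugate.conjExponent hp
  have := Real.young_inequality_of_nonneg hx (Real.rpow_nonneg hl (p - 1)) hpq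
  rw [← Real.rpow_mul hl, mul_div_cancel₀ _ (by linarith)] at this
  have h1 : 0 < p - 1 := by linarith
  have h2 := mul_le_mul_of_nonneg_left this (by linarith : 0 ≤ p)
  calc p * l ^ (p - 1) * x = p * (x * l ^ (p - 1)) := by ring
    _ ≤ _ := h2
    _ = _ := by field_simp

/-- The isocapacitary inequality: the energy of `u` is at least the capacity of the ball with the
volume of `{1 ≤ u}`. With `W t` the volume of `{t ≤ u}`, Young's inequality bounds `‖∇u‖ ^ p` below by
`p l ^ (p - 1) ‖∇u‖ - (p - 1) l ^ p`, where `l` is the slope of the potential of this ball at the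
sphere enclosing the volume `W (u x)`. For this choice the product of `l ^ (p - 1)` with the
perimeter of the sphere does not depend on the level. -/
theorem ballCapacity_mul_rpow_le_lintegral {p : ℝ} (hp : 1 < p) (hpn : p < n)
    (hu : ContDiff ℝ 1 u) (hc : HasCompactSupport u) :
    ENNReal.ofReal (ballCapacity n p * (volume.real {x | 1 ≤ u x} /
        volume.real (Metric.ball (0 : EuclideanSpace ℝ (Fin n)) 1)) ^ ((n - p) / n)) ≤
      ∫⁻ x, ENNReal.ofReal (‖fderiv ℝ u x‖ ^ p) := by
  have hn1 : (1 : ℝ) < n := hp.trans hpn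
  have hn0 : (0 : ℝ) < n := by linarith
  have hn : 2 ≤ n := by exact_mod_cast (by exact_mod_cast hn1 : 1 < n)
  have hω0 : 0 < volume.real (Metric.ball (0 : EuclideanSpace ℝ (Fin n)) 1) :=
    ENNReal.toReal_pos (Metric.measure_ball_pos _ _ one_pos).ne' measure_ball_lt_top.ne
  rcases (measureReal_nonneg (μ := volume) (s := {x | 1 ≤ u x})).eq_or_lt with h0 | hm
  · rw [← h0, zero_div, Real.zero_rpow (div_pos (by linarith) hn0).ne']
    simp
  set K := ballCapacity n p * (volume.real {x | 1 ≤ u x} /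
    volume.real (Metric.ball (0 : EuclideanSpace ℝ (Fin n)) 1)) ^ ((n - p) / n) with hK
  unfold ballCapacity at hK
  set ω := volume.real (Metric.ball (0 : EuclideanSpace ℝ (Fin n)) 1) with hω
  set m := volume.real {x | 1 ≤ u x} with hmdef
  have hp1 : 0 < p - 1 := by linarith
  set a := (n - p) / (p - 1) with ha
  have ha0 : 0 < a := div_pos (by linarith) hp1
  have hap : a * (p - 1) = n - p := div_mul_cancel₀ _ hp1.ne'
  have hap' : (a + 1) * (p - 1) = n - 1 := by linarith
  have hap'' : (a + 1) * p = n + a := by linarith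
  set c := a * (m / ω) ^ (a / n) * ω ^ ((a + 1) / n) with hcdef
  have hc0 : 0 < c := by positivity
  set W : ℝ → ℝ := fun t => volume.real {x | t ≤ u x} with hW
  have hWm : Measurable W := measurable_volume_superlevel u
  have hW1 : ∀ t, 0 < t → t < 1 → m ≤ W t := fun t ht ht1 =>
    measureReal_mono (fun y hy => ht1.le.trans hy)
      (hc.isCompact_superlevel hu.continuous ht).measure_lt_top.ne
  set l : ℝ → ℝ := fun q => c * q ^ (-((a + 1) / n)) with hl
  have hlm : Measurable l := by simp only [hl]; fun_prop
  have hl0 : ∀ q, 0 ≤ q → 0 ≤ l q := fun q hq => by simp only [hl]; positivity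
  have hK0 : 0 ≤ K := by rw [hK]; positivity
  have const : ∀ q, 0 < q → l q ^ (p - 1) * ballPerimeter n q = K := by
    intro q hq
    simp only [hl, hcdef, ballPerimeter]
    rw [Real.mul_rpow (by positivity) (by positivity), Real.mul_rpow (by positivity) (by positivity),
      Real.mul_rpow (by positivity) (by positivity), ← Real.rpow_mul (by positivity),
      ← Real.rpow_mul (by positivity), ← Real.rpow_mul (by positivity),
      show a / n * (p - 1) = (n - p) / n by rw [← hap]; ring,
      show (a + 1) / n * (p - 1) = (n - 1) / n by rw [← hap']; ring,
      show -((a + 1) / n) * (p - 1) = -((n - 1) / n) by rw [← hap']; ring, ← hω, hK,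
      Real.rpow_neg hq.le]
    have h1 : ω ^ ((n - 1) / n : ℝ) * ω ^ (1 / n : ℝ) = ω := by
      rw [← Real.rpow_add hω0, ← add_div]; simp [hn0.ne']
    have h2 : (q ^ ((n - 1) / n : ℝ))⁻¹ * q ^ ((n - 1) / n : ℝ) = 1 :=
      inv_mul_cancel₀ (by positivity)
    calc _ = a ^ (p - 1) * (m / ω) ^ ((n - p) / n) * n *
          (ω ^ ((n - 1) / n : ℝ) * ω ^ (1 / n : ℝ)) *
          ((q ^ ((n - 1) / n : ℝ))⁻¹ * q ^ ((n - 1) / n : ℝ)) := by ring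
      _ = _ := by rw [h1, h2]; ring
  have tail : ∫⁻ x in {x | 0 < u x ∧ u x < 1}, ENNReal.ofReal (l (W (u x)) ^ p) ≤
      ENNReal.ofReal K := by
    have he : (a + 1) / n * p = 1 + a / n := by
      rw [div_mul_eq_mul_div, hap'']; field_simp
    have hlp : ∀ q, 0 ≤ q → l q ^ p = c ^ p * q ^ (-(1 + a / n)) := by
      intro q hq
      simp only [hl]
      rw [Real.mul_rpow hc0.le (by positivity), ← Real.rpow_mul hq, neg_mul, he]
    have hcp : c ^ p = a ^ p * (m / ω) ^ (a / n * p) * ω ^ (1 + a / n) := by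
      rw [hcdef, Real.mul_rpow (by positivity) (by positivity), Real.mul_rpow ha0.le (by positivity),
        ← Real.rpow_mul (by positivity), ← Real.rpow_mul hω0.le, he]
    calc ∫⁻ x in {x | 0 < u x ∧ u x < 1}, ENNReal.ofReal (l (W (u x)) ^ p)
        = ENNReal.ofReal (c ^ p) *
          ∫⁻ x in {x | 0 < u x ∧ u x < 1}, ENNReal.ofReal (W (u x) ^ (-(1 + a / n))) := by
          rw [← lintegral_const_mul' _ _ ENNReal.ofReal_ne_top]
          refine lintegral_congr fun x => ?_
          rw [hlp _ measureReal_nonneg, ENNReal.ofReal_mul (by positivity)]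
      _ ≤ ENNReal.ofReal (c ^ p) * ∫⁻ q in Set.Ioi m, ENNReal.ofReal (q ^ (-(1 + a / n))) := by
          gcongr
          exact setLIntegral_volume_superlevel_rpow_le hu.continuous hc hm (by positivity)
      _ = ENNReal.ofReal (c ^ p) * ENNReal.ofReal (m ^ (-(a / n)) / (a / n)) := by
          have hlt : -(1 + a / n) < -1 := by
            have : 0 < a / n := by positivity
            linarith
          rw [← ofReal_integral_eq_lintegral_ofReal (integrableOn_Ioi_rpow_of_lt hlt hm)
            ((ae_restrict_mem measurableSet_Ioi).mono fun q hq =>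
              Real.rpow_nonneg (hm.trans hq).le _), integral_Ioi_rpow_of_lt hlt hm,
            show -(1 + a / n) + 1 = -(a / n) by ring, neg_div_neg_eq]
      _ = ENNReal.ofReal K := by
          rw [← ENNReal.ofReal_mul (by positivity), hcp, hK]
          congr 1
          have h1 : a ^ p = a ^ (p - 1) * a := by
            rw [← Real.rpow_add_one ha0.ne']; congr 1; ring
          have h2 : (m / ω) ^ (a / n * p) = (m / ω) ^ ((n - p) / n) * (m / ω) ^ (a / n) := by
            rw [← Real.rpow_add (by positivity), ← hap]; congr 1; ring
          have h3 : ω ^ (1 + a / n) = ω * ω ^ (a / n) := by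
            rw [Real.rpow_add hω0, Real.rpow_one]
          rw [h1, h2, h3, Real.rpow_neg hm.le, Real.div_rpow hm.le hω0.le (a / n)]
          field_simp
  have hA : MeasurableSet {x | 0 < u x ∧ u x < 1} :=
    (measurableSet_lt measurable_const hu.continuous.measurable).inter
      (measurableSet_lt hu.continuous.measurable measurable_const)
  have key := lintegral_mul_ballPerimeter_le hn hu hc
    (g := fun t => ENNReal.ofReal (p * l (W t) ^ (p - 1))) (by fun_prop)
  have lhs : ∫⁻ t in Set.Ioo 0 1, ENNReal.ofReal (p * l (W t) ^ (p - 1)) *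
      ENNReal.ofReal (ballPerimeter n (W t)) = ENNReal.ofReal (p * K) := by
    rw [setLIntegral_congr_fun (g := fun _ => ENNReal.ofReal (p * K)) measurableSet_Ioo]
    · simp
    · intro t ht
      have hWt := hW1 t ht.1 ht.2
      have := hl0 (W t) (by linarith)
      simp only
      rw [← ENNReal.ofReal_mul (by positivity), mul_assoc, const _ (by linarith)]
  have rhs : ∫⁻ x in {x | 0 < u x ∧ u x < 1}, ENNReal.ofReal (p * l (W (u x)) ^ (p - 1)) *
      ENNReal.ofReal ‖fderiv ℝ u x‖ ≤
      (∫⁻ x, ENNReal.ofReal (‖fderiv ℝ u x‖ ^ p)) + ENNReal.ofReal ((p - 1) * K) := by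
    calc ∫⁻ x in {x | 0 < u x ∧ u x < 1}, ENNReal.ofReal (p * l (W (u x)) ^ (p - 1)) *
          ENNReal.ofReal ‖fderiv ℝ u x‖
        ≤ ∫⁻ x in {x | 0 < u x ∧ u x < 1}, (ENNReal.ofReal (‖fderiv ℝ u x‖ ^ p) +
          ENNReal.ofReal (p - 1) * ENNReal.ofReal (l (W (u x)) ^ p)) := by
          refine lintegral_mono fun x => ?_
          have := hl0 (W (u x)) measureReal_nonneg
          rw [← ENNReal.ofReal_mul (by positivity), ← ENNReal.ofReal_mul hp1.le,
            ← ENNReal.ofReal_add (by positivity) (by positivity)]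
          exact ENNReal.ofReal_le_ofReal
            (Real.mul_rpow_mul_le_rpow_add hp (norm_nonneg _) this)
      _ = (∫⁻ x in {x | 0 < u x ∧ u x < 1}, ENNReal.ofReal (‖fderiv ℝ u x‖ ^ p)) +
          ENNReal.ofReal (p - 1) *
            ∫⁻ x in {x | 0 < u x ∧ u x < 1}, ENNReal.ofReal (l (W (u x)) ^ p) := by
          have : Measurable fun x => l (W (u x)) :=
            hlm.comp (hWm.comp hu.continuous.measurable)
          rw [lintegral_add_right _ ((this.pow_const p).ennreal_ofReal.const_mul _),
            lintegral_const_mul' _ _ ENNReal.ofReal_ne_top]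
      _ ≤ _ := by
          rw [ENNReal.ofReal_mul hp1.le]
          exact add_le_add (setLIntegral_le_lintegral _ _) (mul_le_mul_right tail _)
  have fin := lhs.symm.le.trans (key.trans rhs)
  rw [show p * K = K + (p - 1) * K by ring, ENNReal.ofReal_add hK0 (by positivity)] at fin
  exact (ENNReal.add_le_add_iff_right ENNReal.ofReal_ne_top).1 fin

end

/-! ### Smooth truncations and radial potentials -/

theorem exists_contDiff_primitive {f : ℝ → ℝ} (hf : ContDiff ℝ ((⊤ : ℕ∞) : WithTop ℕ∞) f) :
    ContDiff ℝ ((⊤ : ℕ∞) : WithTop ℕ∞) (fun s => ∫ r in (0 : ℝ)..s, f r) ∧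
      ∀ s, HasDerivAt (fun s => ∫ r in (0 : ℝ)..s, f r) (f s) s := by
  have h : ∀ s, HasDerivAt (fun s => ∫ r in (0 : ℝ)..s, f r) (f s) s := fun s =>
    intervalIntegral.integral_hasDerivAt_right (hf.continuous.intervalIntegrable _ _)
      (hf.continuous.stronglyMeasurableAtFilter _ _) hf.continuous.continuousAt
  refine ⟨contDiff_infty_iff_deriv.2 ⟨fun s => (h s).differentiableAt, ?_⟩, h⟩
  rwa [show deriv (fun s => ∫ r in (0 : ℝ)..s, f r) = f from funext fun s => (h s).deriv]

/-- Smooth truncations of the identity at the levels `0` and `1`, with slope at most `1 + ε`. -/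
theorem exists_smooth_clamp {ε : ℝ} (hε : 0 < ε) :
    ∃ σ σ' : ℝ → ℝ, ∃ s₀ s₁ : ℝ, ContDiff ℝ ((⊤ : ℕ∞) : WithTop ℕ∞) σ ∧
      (∀ s, HasDerivAt σ (σ' s) s) ∧ 0 < s₀ ∧ s₁ < 1 ∧ (∀ s ≤ s₀, σ s = 0) ∧
      (∀ s, s₁ ≤ s → σ s = 1) ∧ (∀ s, σ s ≤ 1) ∧ (∀ s, 0 ≤ σ' s) ∧ ∀ s, σ' s ≤ 1 + ε := by
  -- The bound on `δ` ensures `1 ≤ (1 + ε) (1 - 4 δ)`.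
  obtain ⟨δ, hδ0, hδ⟩ : ∃ δ, 0 < δ ∧ δ < min (1 / 8) (ε / (4 * (1 + ε))) :=
    exists_between (by positivity)
  obtain ⟨hδ1, hδ2⟩ := lt_min_iff.1 hδ
  rw [lt_div_iff₀ (by positivity)] at hδ2
  let b : ContDiffBump (1 / 2 : ℝ) := ⟨1 / 2 - 2 * δ, 1 / 2 - δ, by linarith, by linarith⟩
  obtain ⟨hF, hF'⟩ := exists_contDiff_primitive (f := b) b.contDiff
  set F : ℝ → ℝ := fun s => ∫ r in (0 : ℝ)..s, b r with hFdef
  have hint : ∀ s t, IntervalIntegrable b volume s t := fun s t =>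
    b.continuous.intervalIntegrable _ _
  have hmono : Monotone F := monotone_of_hasDerivAt_nonneg hF' fun s => b.nonneg' s
  have hb0 : ∀ s, s ≤ δ ∨ 1 - δ ≤ s → b s = 0 := by
    intro s hs
    refine b.zero_of_le_dist ?_
    rw [Real.dist_eq]
    rcases hs with hs | hs
    · exact le_trans (by change 1 / 2 - δ ≤ -(s - 1 / 2); linarith) (neg_le_abs _)
    · exact le_trans (by change 1 / 2 - δ ≤ s - 1 / 2; linarith) (le_abs_self _)
  have hF0 : ∀ s ≤ δ, F s = 0 := by
    intro s hs
    refine intervalIntegral.integral_zero_ae (Filter.Eventually.of_forall fun r hr => hb0 r (Or.inl ?_))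
    rcases Set.mem_uIoc.1 hr with h | h <;> linarith [h.1, h.2]
  have hF1 : ∀ s, 1 - δ ≤ s → F s = F (1 - δ) := by
    intro s hs
    rw [← sub_eq_zero, hFdef, intervalIntegral.integral_interval_sub_left (hint _ _) (hint _ _)]
    refine intervalIntegral.integral_zero_ae (Filter.Eventually.of_forall fun r hr => hb0 r (Or.inr ?_))
    rcases Set.mem_uIoc.1 hr with h | h <;> linarith [h.1, h.2]
  have hI : 1 - 4 * δ ≤ F (1 - δ) := by
    have h1 : F (1 - 2 * δ) - F (2 * δ) = 1 - 4 * δ := by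
      rw [hFdef, intervalIntegral.integral_interval_sub_left (hint _ _) (hint _ _)]
      rw [intervalIntegral.integral_congr (g := fun _ => 1)]
      · simp; ring
      · intro r hr
        rw [Set.uIcc_of_le (by linarith)] at hr
        refine b.one_of_mem_closedBall ?_
        rw [Metric.mem_closedBall, Real.dist_eq, abs_le]
        change -(1 / 2 - 2 * δ) ≤ _ ∧ _ ≤ 1 / 2 - 2 * δ
        constructor <;> linarith [hr.1, hr.2]
    have h2 : F (1 - 2 * δ) ≤ F (1 - δ) := hmono (by linarith)
    have h3 : F 0 ≤ F (2 * δ) := hmono (by linarith)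
    have h4 : F 0 = 0 := hF0 0 hδ0.le
    linarith
  set I := F (1 - δ) with hIdef
  have hI0 : 0 < I := by linarith
  refine ⟨fun s => F s / I, fun s => b s / I, δ, 1 - δ, hF.div_const _,
    fun s => (hF' s).div_const _, hδ0, by linarith, fun s hs => by simp [hF0 s hs],
    fun s hs => by simp [hF1 s hs, hI0.ne'], fun s => ?_,
    fun s => div_nonneg b.nonneg hI0.le, fun s => ?_⟩
  · rw [div_le_one hI0]
    rcases le_total s (1 - δ) with h | h
    · exact hmono h
    · exact (hF1 s h).le
  · rw [div_le_iff₀ hI0]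
    have : (1 + ε) * (1 - 4 * δ) ≤ (1 + ε) * I := by gcongr
    have := b.le_one (x := s)
    nlinarith

/-- Smooth approximations of the positive part, which differ from it by at most `2 ε`. -/
theorem exists_smooth_posPart {ε : ℝ} (hε : 0 < ε) :
    ∃ η η' : ℝ → ℝ, ContDiff ℝ ((⊤ : ℕ∞) : WithTop ℕ∞) η ∧
      (∀ s, HasDerivAt η (η' s) s) ∧ Continuous η' ∧ (∀ s ≤ ε, η s = 0) ∧ (∀ s ≤ ε, η' s = 0) ∧
      (∀ s, 2 * ε ≤ s → η' s = 1) ∧ (∀ s, 0 ≤ η' s) ∧ (∀ s, η' s ≤ 1) ∧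
      ∀ s, s - 2 * ε ≤ η s := by
  set f : ℝ → ℝ := fun s => Real.smoothTransition ((s - ε) / ε) with hf
  have hfs : ContDiff ℝ ((⊤ : ℕ∞) : WithTop ℕ∞) f :=
    Real.smoothTransition.contDiff.comp ((contDiff_id.sub contDiff_const).div_const _)
  obtain ⟨hF, hF'⟩ := exists_contDiff_primitive hfs
  set F : ℝ → ℝ := fun s => ∫ r in (0 : ℝ)..s, f r with hFdef
  have h0 : ∀ s ≤ ε, f s = 0 := fun s hs =>
    Real.smoothTransition.zero_of_nonpos (div_nonpos_of_nonpos_of_nonneg (by linarith) hε.le)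
  have h1 : ∀ s, 2 * ε ≤ s → f s = 1 := fun s hs =>
    Real.smoothTransition.one_of_one_le ((one_le_div hε).2 (by linarith))
  have hF0 : ∀ s ≤ ε, F s = 0 := by
    intro s hs
    refine intervalIntegral.integral_zero_ae (Filter.Eventually.of_forall fun r hr => h0 r ?_)
    rcases Set.mem_uIoc.1 hr with h | h <;> linarith [h.1, h.2]
  have hmono : Monotone F :=
    monotone_of_hasDerivAt_nonneg hF' fun s => Real.smoothTransition.nonneg _
  refine ⟨F, f, hF, hF', hfs.continuous, hF0, h0, h1, fun s => Real.smoothTransition.nonneg _,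
    fun s => Real.smoothTransition.le_one _, fun s => ?_⟩
  have hanti : Monotone fun s => s - F s :=
    monotone_of_hasDerivAt_nonneg (fun s => (hasDerivAt_id s).sub (hF' s))
      fun s => sub_nonneg.2 (Real.smoothTransition.le_one _)
  rcases le_total s (2 * ε) with h | h
  · have : F 0 ≤ F s ∨ s ≤ 0 := (le_total 0 s).imp (fun h => hmono h) id
    rcases this with h' | h'
    · rw [hF0 0 hε.le] at h'; linarith
    · rw [hF0 s (h'.trans hε.le)]; linarith
  · have hc : F s - F (2 * ε) = s - 2 * ε := by
      rw [hFdef, intervalIntegral.integral_interval_sub_left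
        (hfs.continuous.intervalIntegrable _ _) (hfs.continuous.intervalIntegrable _ _),
        intervalIntegral.integral_congr (g := fun _ => 1)]
      · simp
      · intro r hr
        rw [Set.uIcc_of_le h] at hr
        exact h1 r hr.1
    have : F 0 ≤ F (2 * ε) := hmono (by linarith)
    rw [hF0 0 hε.le] at this
    linarith

section

variable {E : Type*} [NormedAddCommGroup E] [InnerProductSpace ℝ E]

theorem contDiffAt_norm_rpow {x : E} (hx : x ≠ 0) (q : ℝ) {k : WithTop ℕ∞} :
    ContDiffAt ℝ k (fun y : E => ‖y‖ ^ q) x :=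
  (contDiffAt_norm ℝ hx).rpow_const_of_ne (norm_ne_zero_iff.2 hx)

variable [CompleteSpace E]

theorem hasGradientAt_norm_rpow {x : E} (hx : x ≠ 0) (q : ℝ) :
    HasGradientAt (fun y => ‖y‖ ^ q) ((q * ‖x‖ ^ (q - 2)) • x) x := by
  have hx' : 0 < ‖x‖ := norm_pos_iff.2 hx
  have h := (hasStrictFDerivAt_norm_sq x).hasFDerivAt.rpow_const (p := q / 2)
    (Or.inl (by positivity))
  rw [hasGradientAt_iff_hasFDerivAt]
  have e : (fun y : E => ‖y‖ ^ q) = fun y => (‖y‖ ^ 2) ^ (q / 2) := by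
    funext y
    rw [← Real.rpow_natCast, ← Real.rpow_mul (norm_nonneg _)]
    congr 1; push_cast; ring
  rw [e]
  refine h.congr_fderiv (ContinuousLinearMap.ext fun y => ?_)
  have e2 : (‖x‖ ^ 2) ^ (q / 2 - 1) = ‖x‖ ^ (q - 2) := by
    rw [← Real.rpow_natCast ‖x‖ 2, ← Real.rpow_mul (norm_nonneg _)]
    congr 1; push_cast; ring
  simp [e2]
  ring

theorem HasDerivAt.comp_hasGradientAt {f : ℝ → ℝ} {f' : ℝ} {u : E → ℝ} {g x : E}
    (hf : HasDerivAt f f' (u x)) (hu : HasGradientAt u g x) :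
    HasGradientAt (fun y => f (u y)) (f' • g) x := by
  rw [hasGradientAt_iff_hasFDerivAt] at *
  exact (hf.comp_hasFDerivAt x hu).congr_fderiv (by simp)

theorem HasGradientAt.sub {u v : E → ℝ} {g h x : E} (hu : HasGradientAt u g x)
    (hv : HasGradientAt v h x) : HasGradientAt (fun y => u y - v y) (g - h) x := by
  rw [hasGradientAt_iff_hasFDerivAt] at *
  exact (HasFDerivAt.sub hu hv).congr_fderiv (by simp)

theorem HasGradientAt.const_mul {u : E → ℝ} {g x : E} (c : ℝ) (hu : HasGradientAt u g x) :
    HasGradientAt (fun y => c * u y) (c • g) x := by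
  rw [hasGradientAt_iff_hasFDerivAt] at *
  exact (HasFDerivAt.const_mul hu c).congr_fderiv (by simp)

theorem norm_gradient (u : E → ℝ) (x : E) : ‖gradient u x‖ = ‖fderiv ℝ u x‖ := by
  simp [gradient]

end

theorem pCapacity_le {N : ℕ} {p : ℝ} {Ω : Set (EuclideanSpace ℝ (Fin N))}
    {u : EuclideanSpace ℝ (Fin N) → ℝ} (hu : ContDiff ℝ ((⊤ : ℕ∞) : WithTop ℕ∞) u)
    (hc : HasCompactSupport u) (h1 : ∀ x ∈ Ω, 1 ≤ u x) :
    pCapacity p Ω ≤ ∫⁻ x, ENNReal.ofReal (‖gradient u x‖ ^ p) :=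
  iInf_le_of_le u (iInf_le_of_le hu (iInf_le_of_le hc (iInf_le _ h1)))

theorem lintegral_indicator_norm_rpow {n : ℕ} (hn : n ≠ 0) {a : ℝ} (ha : 0 < a) :
    ∫⁻ x : EuclideanSpace ℝ (Fin n),
        ENNReal.ofReal ((Set.Ici 1).indicator (fun r => r ^ (-(n + a))) ‖x‖) =
      ENNReal.ofReal (n * volume.real (Metric.ball (0 : EuclideanSpace ℝ (Fin n)) 1) / a) := by
  have hne : Nonempty (Fin n) := ⟨⟨0, Nat.pos_of_ne_zero hn⟩⟩
  have hlt : -(1 + a) < -1 := by linarith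
  have e : Set.EqOn (fun y : ℝ => y ^ (Module.finrank ℝ (EuclideanSpace ℝ (Fin n)) - 1) •
      (Set.Ici (1 : ℝ)).indicator (fun r => r ^ (-(n + a))) y)
      ((Set.Ici (1 : ℝ)).indicator fun y => y ^ (-(1 + a))) (Set.Ioi 0) := by
    intro y hy
    by_cases hy1 : y ∈ Set.Ici (1 : ℝ)
    · simp only [Set.indicator_of_mem hy1, finrank_euclideanSpace_fin, smul_eq_mul]
      rw [← Real.rpow_natCast, ← Real.rpow_add hy, Nat.cast_sub (Nat.pos_of_ne_zero hn)]
      congr 1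
      push_cast
      ring
    · simp [Set.indicator_of_notMem hy1]
  have hio : IntegrableOn (fun y : ℝ => y ^ (-(1 + a))) (Set.Ici 1) :=
    (integrableOn_Ici_iff_integrableOn_Ioi).2 (integrableOn_Ioi_rpow_of_lt hlt one_pos)
  have hi : Integrable fun x : EuclideanSpace ℝ (Fin n) =>
      (Set.Ici 1).indicator (fun r : ℝ => r ^ (-(n + a))) ‖x‖ := by
    rw [integrable_fun_norm_addHaar, integrableOn_congr_fun e measurableSet_Ioi]
    exact (hio.integrable_indicator measurableSet_Ici).integrableOn
  rw [← ofReal_integral_eq_lintegral_ofReal hi (Filter.Eventually.of_forall fun x =>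
    Set.indicator_nonneg (fun r hr => Real.rpow_nonneg (zero_le_one.trans hr) _) _),
    integral_fun_norm_addHaar, setIntegral_congr_fun measurableSet_Ioi e,
    setIntegral_indicator measurableSet_Ici,
    Set.inter_eq_right.2 (Set.Ici_subset_Ioi.2 one_pos), integral_Ici_eq_integral_Ioi,
    integral_Ioi_rpow_of_lt hlt one_pos]
  simp only [finrank_euclideanSpace_fin, Real.one_rpow, smul_eq_mul, nsmul_eq_mul]
  congr 1
  rw [show -(1 + a) + 1 = -a by ring, neg_div_neg_eq]
  ring

/-- The capacity of the unit ball is at most `ballCapacity n p`, as witnessed by smooth truncations of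
the potential `‖x‖ ^ (-a)`, `a = (n - p) / (p - 1)`. -/
theorem pCapacity_ball_le {n : ℕ} {p : ℝ} (hp : 1 < p) (hpn : p < n) :
    pCapacity p (Metric.ball (0 : EuclideanSpace ℝ (Fin n)) 1) ≤
      ENNReal.ofReal (ballCapacity n p) := by
  have hn0 : (0 : ℝ) < n := by linarith
  have hp0 : 0 < p := by linarith
  have hp1 : 0 < p - 1 := by linarith
  set a := (n - p) / (p - 1) with ha
  have ha0 : 0 < a := div_pos (by linarith) hp1
  have hap : (a + 1) * p = n + a := by
    have : a * (p - 1) = n - p := div_mul_cancel₀ _ hp1.ne'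
    linarith
  have key : ∀ ε > 0, pCapacity p (Metric.ball (0 : EuclideanSpace ℝ (Fin n)) 1) ≤
      ENNReal.ofReal ((1 + ε) ^ p * ballCapacity n p) := by
    intro ε hε
    obtain ⟨σ, σ', s₀, s₁, hσ, hσ', hs₀, hs₁, hσ0, hσ1, -, hσ'0, hσ'1⟩ := exists_smooth_clamp hε
    set z : EuclideanSpace ℝ (Fin n) → ℝ := fun x => ‖x‖ ^ (-a) with hz
    set v : EuclideanSpace ℝ (Fin n) → ℝ := fun x => if ‖x‖ < 1 then 1 else σ (z x) with hv
    have hz1 : ∀ x : EuclideanSpace ℝ (Fin n), x ≠ 0 → ‖x‖ < 1 → 1 ≤ z x := fun x hx hx1 =>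
      Real.one_le_rpow_of_pos_of_le_one_of_nonpos (norm_pos_iff.2 hx) hx1.le (by linarith)
    have hvz : ∀ x, x ≠ 0 → v x = σ (z x) := by
      intro x hx
      by_cases h : ‖x‖ < 1
      · simp only [hv, if_pos h]
        exact (hσ1 _ (hs₁.le.trans (hz1 x hx h))).symm
      · simp only [hv, if_neg h]
    have hvz' : ∀ x, x ≠ 0 → v =ᶠ[nhds x] fun y => σ (z y) := fun x hx =>
      Filter.eventually_of_mem (isOpen_ne.mem_nhds hx) fun y hy => hvz y hy
    have hv1 : ∀ x, ‖x‖ < 1 → v =ᶠ[nhds x] fun _ => 1 := fun x hx =>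
      Filter.eventually_of_mem ((isOpen_lt continuous_norm continuous_const).mem_nhds hx)
        fun y hy => if_pos hy
    have hsm : ContDiff ℝ ((⊤ : ℕ∞) : WithTop ℕ∞) v := by
      rw [contDiff_iff_contDiffAt]
      intro x
      by_cases hx : x = 0
      · exact contDiffAt_const.congr_of_eventuallyEq (hv1 x (by simp [hx]))
      · exact (hσ.contDiffAt.comp x (contDiffAt_norm_rpow hx _)).congr_of_eventuallyEq (hvz' x hx)
    have hcs : HasCompactSupport v := by
      refine HasCompactSupport.intro (isCompact_closedBall 0 (max 1 (s₀ ^ (-a⁻¹)))) fun x hx => ?_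
      rw [Metric.mem_closedBall, dist_zero_right, not_le, max_lt_iff] at hx
      have hx0 : 0 < ‖x‖ := one_pos.trans hx.1
      rw [hvz x (norm_pos_iff.1 hx0)]
      refine hσ0 _ ?_
      rw [← inv_neg, Real.rpow_inv_lt_iff_of_neg hs₀ hx0 (by linarith)] at hx
      exact hx.2.le
    have hgrad : ∀ x, ‖gradient v x‖ ^ p ≤
        (1 + ε) ^ p * a ^ p * (Set.Ici 1).indicator (fun r : ℝ => r ^ (-(n + a))) ‖x‖ := by
      intro x
      by_cases hx : ‖x‖ < 1
      · have : gradient v x = 0 := by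
          rw [(hv1 x hx).gradient_eq]; simp
        rw [this, norm_zero, Real.zero_rpow hp0.ne', Set.indicator_of_notMem (by simpa using hx),
          mul_zero]
      · have hx1 : 1 ≤ ‖x‖ := not_lt.1 hx
        have hx0 : 0 < ‖x‖ := one_pos.trans_le hx1
        have hx' := norm_pos_iff.1 hx0
        have hg : HasGradientAt (fun y => σ (z y)) (σ' (z x) • ((-a * ‖x‖ ^ (-a - 2)) • x)) x :=
          (hσ' (z x)).comp_hasGradientAt (hasGradientAt_norm_rpow hx' _)
        rw [(hvz' x hx').gradient_eq, hg.gradient, Set.indicator_of_mem (Set.mem_Ici.2 hx1)]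
        have e1 : ‖σ' (z x) • ((-a * ‖x‖ ^ (-a - 2)) • x)‖ = σ' (z x) * (a * ‖x‖ ^ (-(a + 1))) := by
          rw [norm_smul, norm_smul, Real.norm_of_nonneg (hσ'0 _), norm_mul, norm_neg,
            Real.norm_of_nonneg ha0.le, Real.norm_of_nonneg (by positivity), mul_assoc a,
            ← Real.rpow_add_one hx0.ne']
          congr 3; ring
        rw [e1]
        calc (σ' (z x) * (a * ‖x‖ ^ (-(a + 1)))) ^ p
            ≤ ((1 + ε) * (a * ‖x‖ ^ (-(a + 1)))) ^ p := by
              have := hσ'0 (z x)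
              gcongr
              exact hσ'1 _
          _ = _ := by
              rw [Real.mul_rpow (by positivity) (by positivity),
                Real.mul_rpow ha0.le (by positivity), ← Real.rpow_mul hx0.le, neg_mul, hap]
              ring
    refine (pCapacity_le hsm hcs fun x hx => ?_).trans ?_
    · simp only [hv, if_pos (mem_ball_zero_iff.1 hx)]; exact le_rfl
    calc ∫⁻ x, ENNReal.ofReal (‖gradient v x‖ ^ p)
        ≤ ∫⁻ x : EuclideanSpace ℝ (Fin n), ENNReal.ofReal ((1 + ε) ^ p * a ^ p) *
            ENNReal.ofReal ((Set.Ici 1).indicator (fun r : ℝ => r ^ (-(n + a))) ‖x‖) := by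
          refine lintegral_mono fun x => ?_
          rw [← ENNReal.ofReal_mul (by positivity)]
          exact ENNReal.ofReal_le_ofReal (hgrad x)
      _ = ENNReal.ofReal ((1 + ε) ^ p * ballCapacity n p) := by
          rw [lintegral_const_mul' _ _ ENNReal.ofReal_ne_top,
            lintegral_indicator_norm_rpow (by exact_mod_cast hn0.ne') ha0,
            ← ENNReal.ofReal_mul (by positivity), ballCapacity, ← ha]
          congr 1
          rw [show a ^ p = a ^ (p - 1) * a by rw [← Real.rpow_add_one ha0.ne']; congr 1; ring]
          field_simp
  have lim : Filter.Tendsto (fun ε : ℝ => ENNReal.ofReal ((1 + ε) ^ p * ballCapacity n p))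
      (nhdsWithin 0 (Set.Ioi 0)) (nhds (ENNReal.ofReal (ballCapacity n p))) := by
    have hc : Continuous fun ε : ℝ => ENNReal.ofReal ((1 + ε) ^ p * ballCapacity n p) :=
      ENNReal.continuous_ofReal.comp
        (((continuous_const.add continuous_id).rpow_const fun _ => Or.inr hp0.le).mul
          continuous_const)
    have := (hc.tendsto 0).mono_left (nhdsWithin_le_nhds (s := Set.Ioi 0))
    simpa using this
  exact ge_of_tendsto lim (eventually_nhdsWithin_of_forall key)

/-! ### The radial potential is `p`-harmonic -/

section

variable {n : ℕ}

/-- The divergence theorem for the vector field `ψ x • x`. -/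
theorem integral_fderiv_apply_self {ψ : EuclideanSpace ℝ (Fin n) → ℝ} (hψ : ContDiff ℝ 1 ψ)
    (hc : HasCompactSupport ψ) :
    Integrable (fun x => fderiv ℝ ψ x x) ∧ ∫ x, fderiv ℝ ψ x x = -(n * ∫ x, ψ x) := by
  have hd : Differentiable ℝ ψ := hψ.differentiable one_ne_zero
  have hcf : Continuous (fderiv ℝ ψ) := hψ.continuous_fderiv one_ne_zero
  let e : Fin n → EuclideanSpace ℝ (Fin n) := fun i => EuclideanSpace.single i 1
  have hterm : ∀ i, Integrable (fun x : EuclideanSpace ℝ (Fin n) => x i * fderiv ℝ ψ x (e i)) := by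
    intro i
    refine Continuous.integrable_of_hasCompactSupport (by fun_prop) ?_
    exact ((hc.fderiv ℝ).comp_left (g := fun L : EuclideanSpace ℝ (Fin n) →L[ℝ] ℝ => L (e i))
      (by simp)).mul_left
  have hψi : Integrable ψ := hψ.continuous.integrable_of_hasCompactSupport hc
  have hcoord : ∀ i, ∫ x : EuclideanSpace ℝ (Fin n), x i * fderiv ℝ ψ x (e i) = -∫ x, ψ x := by
    intro i
    have hfd : ∀ x : EuclideanSpace ℝ (Fin n),
        fderiv ℝ (fun y : EuclideanSpace ℝ (Fin n) => y i) x (e i) = 1 := by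
      intro x
      rw [show (fun y : EuclideanSpace ℝ (Fin n) => y i) =
        (EuclideanSpace.proj i : EuclideanSpace ℝ (Fin n) →L[ℝ] ℝ) from rfl,
        ContinuousLinearMap.fderiv]
      simp [e]
    have := integral_mul_fderiv_eq_neg_fderiv_mul_of_integrable
      (μ := (volume : Measure (EuclideanSpace ℝ (Fin n))))
      (f := fun x : EuclideanSpace ℝ (Fin n) => x i) (g := ψ) (v := e i)
      (by simpa only [hfd, one_mul] using hψi) (hterm i)
      (Continuous.integrable_of_hasCompactSupport (by have := hψ.continuous; fun_prop) hc.mul_left)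
      (fun x _ => by fun_prop) (fun x _ => hd x)
    simpa only [hfd, one_mul] using this
  have hsum : ∀ x : EuclideanSpace ℝ (Fin n),
      fderiv ℝ ψ x x = ∑ i, x i * fderiv ℝ ψ x (e i) := by
    intro x
    have := congrArg (fderiv ℝ ψ x) ((EuclideanSpace.basisFun (Fin n) ℝ).sum_repr x)
    rw [← this]
    simp [e]
  simp only [hsum]
  refine ⟨integrable_finsetSum _ fun i _ => hterm i, ?_⟩
  rw [integral_finsetSum _ fun i _ => hterm i, Finset.sum_congr rfl fun i _ => hcoord i]
  simp

/-- The field `‖x‖ ^ (-n) • x` is divergence free away from the origin. -/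
theorem integral_norm_rpow_mul_inner_gradient {φ : EuclideanSpace ℝ (Fin n) → ℝ}
    (hφ : ContDiff ℝ 1 φ) (hc : HasCompactSupport φ) (h0 : φ =ᶠ[nhds 0] 0) :
    Integrable (fun x => ‖x‖ ^ (-(n : ℝ)) * inner ℝ x (gradient φ x)) ∧
      ∫ x, ‖x‖ ^ (-(n : ℝ)) * inner ℝ x (gradient φ x) = 0 := by
  set ψ : EuclideanSpace ℝ (Fin n) → ℝ := fun x => ‖x‖ ^ (-(n : ℝ)) * φ x with hψ
  have hψ0 : ψ =ᶠ[nhds 0] 0 := by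
    filter_upwards [h0] with x hx
    simp [hψ, hx]
  have hψs : ContDiff ℝ 1 ψ := by
    rw [contDiff_iff_contDiffAt]
    intro x
    by_cases hx : x = 0
    · subst hx
      exact contDiffAt_const.congr_of_eventuallyEq hψ0
    · exact (contDiffAt_norm_rpow hx _).mul hφ.contDiffAt
  have hψc : HasCompactSupport ψ := hc.mul_left
  obtain ⟨hi, hI⟩ := integral_fderiv_apply_self hψs hψc
  have hψi : Integrable ψ := hψs.continuous.integrable_of_hasCompactSupport hψc
  have e : ∀ x, ‖x‖ ^ (-(n : ℝ)) * inner ℝ x (gradient φ x) = fderiv ℝ ψ x x + n * ψ x := by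
    intro x
    by_cases hx : x = 0
    · subst hx
      simp [hψ0.self_of_nhds]
    · have h1 := (hasGradientAt_norm_rpow hx (-(n : ℝ))).hasFDerivAt
      have h2 := (hφ.differentiable one_ne_zero x).hasFDerivAt
      have h3 : fderiv ℝ ψ x x = ‖x‖ ^ (-(n : ℝ)) * fderiv ℝ φ x x +
          φ x * (-n * ‖x‖ ^ (-(n : ℝ) - 2) * (‖x‖ * ‖x‖)) := by
        have h12 : HasFDerivAt ψ _ x := h1.mul h2
        rw [h12.fderiv]
        simp [sq]
      have h4 : inner ℝ x (gradient φ x) = fderiv ℝ φ x x := by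
        rw [real_inner_comm, gradient, InnerProductSpace.toDual_symm_apply]
      have hx0 := norm_pos_iff.2 hx
      have h5 : ‖x‖ ^ (-(n : ℝ) - 2) * (‖x‖ * ‖x‖) = ‖x‖ ^ (-(n : ℝ)) := by
        rw [← mul_assoc, ← Real.rpow_add_one hx0.ne', ← Real.rpow_add_one hx0.ne']
        congr 1; ring
      rw [h3, h4, mul_assoc, h5, hψ]
      ring
  simp only [e]
  refine ⟨hi.add (hψi.const_mul _), ?_⟩
  rw [integral_add hi (hψi.const_mul _), hI, integral_const_mul]
  ring

end

/-! ### The energy gap -/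

section

variable {E : Type*} [NormedAddCommGroup E] [InnerProductSpace ℝ E]

theorem rpow_sub_two_mul_inner_self (a : E) {p : ℝ} (hp : 1 < p) :
    ‖a‖ ^ (p - 2) * inner ℝ a a = ‖a‖ ^ p := by
  rcases eq_or_ne a 0 with rfl | ha
  · simp [Real.zero_rpow (by linarith : p ≠ 0)]
  · have := norm_pos_iff.2 ha
    rw [real_inner_self_eq_norm_mul_norm, ← mul_assoc, ← Real.rpow_add_one this.ne',
      ← Real.rpow_add_one this.ne']
    congr 1; ring

theorem mul_rpow_sub_two_mul_inner_le (a b : E) {p : ℝ} (hp : 1 < p) :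
    p * (‖a‖ ^ (p - 2) * inner ℝ a b) ≤ ‖b‖ ^ p + (p - 1) * ‖a‖ ^ p := by
  rcases eq_or_ne a 0 with rfl | ha
  · simp [Real.zero_rpow (by linarith : p ≠ 0), Real.rpow_nonneg]
  · have h0 := norm_pos_iff.2 ha
    calc p * (‖a‖ ^ (p - 2) * inner ℝ a b) ≤ p * (‖a‖ ^ (p - 2) * (‖a‖ * ‖b‖)) := by
          have := real_inner_le_norm a b
          gcongr
      _ = p * ‖a‖ ^ (p - 1) * ‖b‖ := by
          rw [← mul_assoc (‖a‖ ^ (p - 2)), ← Real.rpow_add_one h0.ne',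
            show p - 2 + 1 = p - 1 by ring, mul_assoc]
      _ ≤ _ := Real.mul_rpow_mul_le_rpow_add hp (norm_nonneg _) (norm_nonneg _)

/-- The fraction `θ` of the gradient of the potential that is used to build a second, larger barrier.
Any `θ < (p - 1) / p` would do: what matters is that `p - 1 - p θ` is positive. -/
noncomputable def barrierSlope (p : ℝ) : ℝ := (p - 1) / (2 * p)

/-- The constant in `rpow_norm_add_le_of_barrier`. -/
noncomputable def barrierConst (p : ℝ) : ℝ := min 1 ((p - 1) / 2) / 2 ^ (p - 1)

theorem barrierConst_pos {p : ℝ} (hp : 1 < p) : 0 < barrierConst p := by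
  have : 0 < (p - 1) / 2 := by linarith
  unfold barrierConst; positivity

theorem barrierSlope_pos {p : ℝ} (hp : 1 < p) : 0 < barrierSlope p :=
  div_pos (by linarith) (by linarith)

theorem barrierSlope_le_one {p : ℝ} (hp : 1 < p) : barrierSlope p ≤ 1 := by
  unfold barrierSlope; rw [div_le_one (by linarith)]; linarith

theorem mul_rpow_norm_sub_le (a b : E) {p : ℝ} (hp : 1 < p) :
    barrierConst p * ‖b - barrierSlope p • a‖ ^ p ≤ ‖b‖ ^ p + (p - 1) / 2 * ‖a‖ ^ p := by
  have hp0 : 0 < p := by linarith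
  set θ := barrierSlope p with hθ
  have hθ0 := barrierSlope_pos hp
  have hθ1 := barrierSlope_le_one hp
  have h2 : (0 : ℝ) < 2 ^ (p - 1) := by positivity
  have h3 : ‖b - θ • a‖ ^ p ≤ 2 ^ (p - 1) * (‖b‖ ^ p + ‖a‖ ^ p) := by
    calc ‖b - θ • a‖ ^ p ≤ (‖b‖ + ‖a‖) ^ p := by
          gcongr
          refine (norm_sub_le _ _).trans ?_
          rw [norm_smul, Real.norm_of_nonneg hθ0.le]
          nlinarith [norm_nonneg a]
      _ ≤ _ := by
          exact_mod_cast NNReal.rpow_add_le_mul_rpow_add_rpow ‖b‖₊ ‖a‖₊ hp.le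
  calc barrierConst p * ‖b - θ • a‖ ^ p
      ≤ barrierConst p * (2 ^ (p - 1) * (‖b‖ ^ p + ‖a‖ ^ p)) := by
        have := barrierConst_pos hp
        gcongr
    _ = min 1 ((p - 1) / 2) * ‖b‖ ^ p + min 1 ((p - 1) / 2) * ‖a‖ ^ p := by
        unfold barrierConst; field_simp
    _ ≤ 1 * ‖b‖ ^ p + (p - 1) / 2 * ‖a‖ ^ p := by
        gcongr
        · exact min_le_left _ _
        · exact min_le_right _ _
    _ = _ := by ring

/-- Pointwise energy comparison. Here `b` is the gradient of a competitor `w`, `a` that of a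
potential, `b - t₁ • (b - a)` that of a smooth version of their minimum, and `t₂ • (b - θ • a)` that of
the positive part of the difference of `w` and a barrier. The terms with inner products integrate to
zero when the potential is `p`-harmonic. -/
theorem rpow_norm_add_le_of_barrier (a b : E) {p t₁ t₂ : ℝ} (hp : 1 < p) (ht₂ : 0 ≤ t₂)
    (h12 : t₂ ≤ t₁) (ht₁ : t₁ ≤ 1) :
    ‖b - t₁ • (b - a)‖ ^ p + barrierConst p * ‖t₂ • (b - barrierSlope p • a)‖ ^ p +
        p * (‖a‖ ^ (p - 2) * inner ℝ a (t₁ • (b - a))) -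
        p * (‖a‖ ^ (p - 2) * inner ℝ a (t₂ • (b - barrierSlope p • a))) ≤ ‖b‖ ^ p := by
  have hp0 : 0 < p := by linarith
  have ht10 : 0 ≤ t₁ := ht₂.trans h12
  have h1 : ‖b - t₁ • (b - a)‖ ^ p ≤ (1 - t₁) * ‖b‖ ^ p + t₁ * ‖a‖ ^ p := by
    have hn : ‖b - t₁ • (b - a)‖ ≤ (1 - t₁) * ‖b‖ + t₁ * ‖a‖ := by
      rw [show b - t₁ • (b - a) = (1 - t₁) • b + t₁ • a by module]
      refine (norm_add_le _ _).trans (le_of_eq ?_)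
      rw [norm_smul, norm_smul, Real.norm_of_nonneg ht10, Real.norm_of_nonneg (by linarith)]
    refine (Real.rpow_le_rpow (norm_nonneg _) hn hp0.le).trans ?_
    exact (convexOn_rpow hp.le).2 (norm_nonneg b) (norm_nonneg a) (by linarith) ht10 (by ring)
  have h2 : ‖t₂ • (b - barrierSlope p • a)‖ ^ p ≤ t₂ * ‖b - barrierSlope p • a‖ ^ p := by
    rw [norm_smul, Real.norm_of_nonneg ht₂, Real.mul_rpow ht₂ (norm_nonneg _)]
    gcongr
    exact Real.rpow_le_self_of_le_one ht₂ (h12.trans ht₁) hp.le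
  have h3 := mul_rpow_norm_sub_le a b hp
  have h4 := mul_rpow_sub_two_mul_inner_le a b hp
  have h5 := rpow_sub_two_mul_inner_self a hp
  simp only [inner_smul_right, inner_sub_right]
  have hθ : p * barrierSlope p = (p - 1) / 2 := by unfold barrierSlope; field_simp
  set A := ‖a‖ ^ p with hA
  set B := ‖b‖ ^ p with hB
  set G := ‖a‖ ^ (p - 2) * inner ℝ a b with hG
  have e1 : p * (‖a‖ ^ (p - 2) * (t₁ * (inner ℝ a b - inner ℝ a a))) = t₁ * (p * G - p * A) := by
    rw [hG, ← h5]; ring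
  have e2 : p * (‖a‖ ^ (p - 2) * (t₂ * (inner ℝ a b - barrierSlope p * inner ℝ a a))) =
      t₂ * (p * G - (p - 1) / 2 * A) := by
    rw [hG, ← h5, ← hθ]; ring
  rw [e1, e2]
  have h6 : barrierConst p * ‖t₂ • (b - barrierSlope p • a)‖ ^ p ≤ t₂ * (B + (p - 1) / 2 * A) := by
    calc _ ≤ barrierConst p * (t₂ * ‖b - barrierSlope p • a‖ ^ p) := by
          have := barrierConst_pos hp
          gcongr
      _ = t₂ * (barrierConst p * ‖b - barrierSlope p • a‖ ^ p) := by ring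
      _ ≤ _ := by gcongr
  have h7 : t₂ * (B + (p - 1) * A - p * G) ≤ t₁ * (B + (p - 1) * A - p * G) :=
    mul_le_mul_of_nonneg_right h12 (by linarith)
  linarith

end

/-! ### Barriers built from the potential of a ball -/

section

variable {n : ℕ} {w : EuclideanSpace ℝ (Fin n) → ℝ}

/-- The gradient of the potential `(S / ‖x‖) ^ a`. -/
noncomputable def potentialGradient (a S : ℝ) (x : EuclideanSpace ℝ (Fin n)) :
    EuclideanSpace ℝ (Fin n) :=
  S ^ a • ((-a * ‖x‖ ^ (-a - 2)) • x)

/-- A smooth version of the positive part of the difference of `w` and the barrier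
`1 - θ (1 - (S / ‖x‖) ^ a)`, extended by zero to the ball of radius `S`. -/
noncomputable def barrierExcess (η : ℝ → ℝ) (w : EuclideanSpace ℝ (Fin n) → ℝ) (a S θ : ℝ)
    (x : EuclideanSpace ℝ (Fin n)) : ℝ :=
  if ‖x‖ < S then 0 else η (w x - (1 - θ * (1 - S ^ a * ‖x‖ ^ (-a))))

theorem one_le_potential {a S : ℝ} (ha : 0 < a) {x : EuclideanSpace ℝ (Fin n)}
    (hx : x ≠ 0) (hxS : ‖x‖ ≤ S) : 1 ≤ S ^ a * ‖x‖ ^ (-a) := by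
  have hx0 := norm_pos_iff.2 hx
  rw [Real.rpow_neg hx0.le, ← div_eq_mul_inv, one_le_div (by positivity)]
  gcongr

theorem barrierExcess_of_ne_zero {η : ℝ → ℝ} {a S θ ε : ℝ} (hε : 0 < ε) (hη0 : ∀ s ≤ ε, η s = 0)
    (ha : 0 < a) (hθ : 0 ≤ θ) (hw1 : ∀ x, w x ≤ 1) {x : EuclideanSpace ℝ (Fin n)} (hx : x ≠ 0) :
    barrierExcess η w a S θ x = η (w x - (1 - θ * (1 - S ^ a * ‖x‖ ^ (-a)))) := by
  by_cases h : ‖x‖ < S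
  · rw [barrierExcess, if_pos h, hη0]
    have h1 := one_le_potential ha hx h.le
    have h2 : θ * (1 - S ^ a * ‖x‖ ^ (-a)) ≤ 0 := mul_nonpos_of_nonneg_of_nonpos hθ (by linarith)
    linarith [hw1 x]
  · rw [barrierExcess, if_neg h]

theorem barrierExcess_eventuallyEq_zero (η : ℝ → ℝ) (w : EuclideanSpace ℝ (Fin n) → ℝ) (a θ : ℝ)
    {S : ℝ} (hS : 0 < S) : barrierExcess η w a S θ =ᶠ[nhds 0] 0 :=
  Filter.eventually_of_mem (Metric.ball_mem_nhds _ hS) fun _ hy =>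
    if_pos (mem_ball_zero_iff.1 hy)

theorem hasGradientAt_barrierExcess {η η' : ℝ → ℝ} {a S θ ε : ℝ} (hε : 0 < ε)
    (hη0 : ∀ s ≤ ε, η s = 0) (hη' : ∀ s, HasDerivAt η (η' s) s) (ha : 0 < a)
    (hθ : 0 ≤ θ) (hw1 : ∀ x, w x ≤ 1) (hw : Differentiable ℝ w) {x : EuclideanSpace ℝ (Fin n)}
    (hx : x ≠ 0) :
    HasGradientAt (barrierExcess η w a S θ)
      (η' (w x - (1 - θ * (1 - S ^ a * ‖x‖ ^ (-a)))) •
        (gradient w x - θ • potentialGradient a S x)) x := by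
  have e : barrierExcess η w a S θ =ᶠ[nhds x]
      fun y => η (w y - (1 - θ * (1 - S ^ a * ‖y‖ ^ (-a)))) :=
    Filter.eventually_of_mem (isOpen_ne.mem_nhds hx) fun y hy =>
      barrierExcess_of_ne_zero hε hη0 ha hθ hw1 hy
  refine HasGradientAt.congr_of_eventuallyEq ?_ e
  refine (hη' _).comp_hasGradientAt (u := fun y => w y - (1 - θ * (1 - S ^ a * ‖y‖ ^ (-a)))) ?_
  refine (hw x).hasGradientAt.sub ?_
  have h := ((hasGradientAt_norm_rpow hx (-a)).const_mul (S ^ a)).const_mul θ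
  rw [hasGradientAt_iff_hasFDerivAt] at h ⊢
  refine (h.const_add (1 - θ)).congr_of_eventuallyEq (Filter.Eventually.of_forall fun y => ?_)
  simp only
  ring

theorem contDiff_barrierExcess {η : ℝ → ℝ} {a S θ ε : ℝ} (hε : 0 < ε) (hη0 : ∀ s ≤ ε, η s = 0)
    {k : WithTop ℕ∞} (hη : ContDiff ℝ k η) (ha : 0 < a) (hS : 0 < S) (hθ : 0 ≤ θ)
    (hw1 : ∀ x, w x ≤ 1) (hw : ContDiff ℝ k w) : ContDiff ℝ k (barrierExcess η w a S θ) := by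
  rw [contDiff_iff_contDiffAt]
  intro x
  by_cases hx : x = 0
  · subst hx
    exact contDiffAt_const.congr_of_eventuallyEq (barrierExcess_eventuallyEq_zero η w a θ hS)
  · have e : barrierExcess η w a S θ =ᶠ[nhds x]
        fun y => η (w y - (1 - θ * (1 - S ^ a * ‖y‖ ^ (-a)))) :=
      Filter.eventually_of_mem (isOpen_ne.mem_nhds hx) fun y hy =>
        barrierExcess_of_ne_zero hε hη0 ha hθ hw1 hy
    refine ContDiffAt.congr_of_eventuallyEq ?_ e
    refine hη.contDiffAt.comp x (hw.contDiffAt.sub ?_)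
    exact contDiffAt_const.sub (contDiffAt_const.mul (contDiffAt_const.sub
      (contDiffAt_const.mul (contDiffAt_norm_rpow hx _))))

theorem hasCompactSupport_barrierExcess {η : ℝ → ℝ} {a S θ ε : ℝ} (hε : 0 < ε)
    (hη0 : ∀ s ≤ ε, η s = 0) (hS : 0 < S) (hθ : 0 ≤ θ) (hθ1 : θ ≤ 1)
    (hc : HasCompactSupport w) : HasCompactSupport (barrierExcess η w a S θ) := by
  refine HasCompactSupport.intro hc.isCompact fun x hx => ?_
  have hx0 : w x = 0 := image_eq_zero_of_notMem_tsupport hx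
  by_cases h : ‖x‖ < S
  · exact if_pos h
  · rw [barrierExcess, if_neg h, hx0]
    refine hη0 _ ?_
    have : 0 ≤ θ * (S ^ a * ‖x‖ ^ (-a)) := by positivity
    linarith

/-- The flux `‖∇z‖ ^ (p - 2) ∇z` of the potential `z` is a multiple of `‖x‖ ^ (-n) • x`, so that it is
orthogonal to gradients of functions which vanish near the origin. -/
theorem integral_potential_flux_inner_gradient {p S : ℝ} (hp : 1 < p) (hpn : p < n) (hS : 0 < S)
    {φ : EuclideanSpace ℝ (Fin n) → ℝ} (hφ : ContDiff ℝ 1 φ) (hc : HasCompactSupport φ)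
    (h0 : φ =ᶠ[nhds 0] 0) :
    Integrable (fun x => ‖potentialGradient (n := n) ((n - p) / (p - 1)) S x‖ ^ (p - 2) *
      inner ℝ (potentialGradient ((n - p) / (p - 1)) S x) (gradient φ x)) ∧
    ∫ x, ‖potentialGradient (n := n) ((n - p) / (p - 1)) S x‖ ^ (p - 2) *
      inner ℝ (potentialGradient ((n - p) / (p - 1)) S x) (gradient φ x) = 0 := by
  have hp1 : 0 < p - 1 := by linarith
  set a := (n - p) / (p - 1) with ha
  have ha0 : 0 < a := div_pos (by linarith) hp1
  have hap : a * (p - 1) = n - p := div_mul_cancel₀ _ hp1.ne'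
  obtain ⟨hi, hI⟩ := integral_norm_rpow_mul_inner_gradient hφ hc h0
  have e : ∀ x : EuclideanSpace ℝ (Fin n), ‖potentialGradient a S x‖ ^ (p - 2) *
      inner ℝ (potentialGradient a S x) (gradient φ x) =
      -((S ^ a * a) ^ (p - 1)) * (‖x‖ ^ (-(n : ℝ)) * inner ℝ x (gradient φ x)) := by
    intro x
    by_cases hx : x = 0
    · simp [hx, potentialGradient]
    have hx0 := norm_pos_iff.2 hx
    have hn : ‖potentialGradient a S x‖ = (S ^ a * a) * ‖x‖ ^ (-(a + 1)) := by
      rw [potentialGradient, norm_smul, norm_smul, norm_mul, norm_neg,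
        Real.norm_of_nonneg ha0.le, Real.norm_of_nonneg (by positivity),
        Real.norm_of_nonneg (by positivity), mul_assoc a, ← Real.rpow_add_one hx0.ne',
        show -a - 2 + 1 = -(a + 1) by ring, mul_assoc]
    have h1 : (S ^ a * a) ^ (p - 1) = (S ^ a * a) ^ (p - 2) * (S ^ a * a) := by
      rw [← Real.rpow_add_one (by positivity)]; congr 1; ring
    have h2 : ‖x‖ ^ (-(n : ℝ)) = ‖x‖ ^ (-(a + 1) * (p - 2)) * ‖x‖ ^ (-a - 2) := by
      rw [← Real.rpow_add hx0]; congr 1; linear_combination hap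
    rw [hn, Real.mul_rpow (by positivity) (by positivity), ← Real.rpow_mul hx0.le, h1, h2,
      potentialGradient, real_inner_smul_left, real_inner_smul_left]
    ring
  simp only [e]
  exact ⟨hi.const_mul _, by rw [integral_const_mul, hI, mul_zero]⟩

/-- Scaled form of the isocapacitary inequality, for sets on which `φ` is at least `μ`. -/
theorem mul_rpow_volume_le_lintegral {p μ : ℝ} (hp : 1 < p) (hpn : p < n) (hμ : 0 < μ)
    {φ : EuclideanSpace ℝ (Fin n) → ℝ} (hφ : ContDiff ℝ 1 φ) (hc : HasCompactSupport φ)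
    {D : Set (EuclideanSpace ℝ (Fin n))} (hD : ∀ x ∈ D, μ ≤ φ x) :
    ENNReal.ofReal (μ ^ p * (ballCapacity n p * (volume.real D /
        volume.real (Metric.ball (0 : EuclideanSpace ℝ (Fin n)) 1)) ^ ((n - p) / n))) ≤
      ∫⁻ x, ENNReal.ofReal (‖gradient φ x‖ ^ p) := by
  have h := ballCapacity_mul_rpow_le_lintegral hp hpn (u := fun x => μ⁻¹ * φ x)
    (contDiff_const.mul hφ) hc.mul_left
  have hsub : D ⊆ {x | 1 ≤ μ⁻¹ * φ x} := by
    intro x hx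
    have := hD x hx
    rw [Set.mem_ofPred_eq, ← div_eq_inv_mul, one_le_div hμ]
    exact this
  have hfin : volume {x | 1 ≤ μ⁻¹ * φ x} ≠ ∞ :=
    (HasCompactSupport.isCompact_superlevel (u := fun x => μ⁻¹ * φ x)
      (continuous_const.mul hφ.continuous) hc.mul_left one_pos).measure_lt_top.ne
  have hκ := ballCapacity_pos hp hpn
  have hexp : 0 ≤ (n - p) / n := div_nonneg (by linarith) (by linarith)
  calc _ ≤ ENNReal.ofReal (μ ^ p * (ballCapacity n p * (volume.real {x | 1 ≤ μ⁻¹ * φ x} /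
        volume.real (Metric.ball (0 : EuclideanSpace ℝ (Fin n)) 1)) ^ ((n - p) / n))) := by
        have := measureReal_mono hsub hfin
        refine ENNReal.ofReal_le_ofReal ?_
        gcongr
    _ = ENNReal.ofReal (μ ^ p) * ENNReal.ofReal ((ballCapacity n p *
        (volume.real {x | 1 ≤ μ⁻¹ * φ x} /
        volume.real (Metric.ball (0 : EuclideanSpace ℝ (Fin n)) 1)) ^ ((n - p) / n))) :=
        ENNReal.ofReal_mul (by positivity)
    _ ≤ ENNReal.ofReal (μ ^ p) *
        ∫⁻ x, ENNReal.ofReal (‖fderiv ℝ (fun x => μ⁻¹ * φ x) x‖ ^ p) := by gcongr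
    _ = _ := by
        rw [← lintegral_const_mul' _ _ ENNReal.ofReal_ne_top]
        refine lintegral_congr fun x => ?_
        rw [← ENNReal.ofReal_mul (by positivity), fderiv_const_mul
          (hφ.differentiable one_ne_zero x), norm_smul, norm_gradient,
          ← Real.mul_rpow hμ.le (by positivity), Real.norm_of_nonneg (by positivity), ← mul_assoc,
          mul_inv_cancel₀ hμ.ne', one_mul]

theorem integrable_rpow_norm_gradient {p : ℝ} (hp : 0 < p) (hw : ContDiff ℝ 1 w)
    (hc : HasCompactSupport w) : Integrable fun x => ‖gradient w x‖ ^ p := by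
  simp only [norm_gradient]
  have h := hw.continuous_fderiv one_ne_zero
  refine Continuous.integrable_of_hasCompactSupport
    (h.norm.rpow_const fun x => Or.inr hp.le) ?_
  exact (hc.fderiv ℝ).norm.comp_left (g := fun t : ℝ => t ^ p) (Real.zero_rpow hp.ne')

/-! ### Comparison of capacities -/

/-- The energy gap for a competitor `w` bounded by one: cutting `w` down to the potential of the ball
of radius `S` gives a competitor for `Ω ∩ B_S`, and the energy saved controls the energy of the excess
of `w` over the barrier. -/
theorem pCapacity_inter_add_le_lintegral {p S S' ε : ℝ} (hp : 1 < p) (hpn : p < n) (hS : 0 < S)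
    (hSS' : S < S') (hε : 0 < ε) {Ω : Set (EuclideanSpace ℝ (Fin n))}
    (hw : ContDiff ℝ ((⊤ : ℕ∞) : WithTop ℕ∞) w) (hc : HasCompactSupport w) (hw1 : ∀ x, w x ≤ 1)
    (hwΩ : ∀ x ∈ Ω, w x = 1)
    (hμ : 0 < barrierSlope p * (1 - (S / S') ^ ((n - p) / (p - 1))) - 4 * ε) :
    pCapacity p (Ω ∩ Metric.ball 0 S) + ENNReal.ofReal (barrierConst p *
      ((barrierSlope p * (1 - (S / S') ^ ((n - p) / (p - 1))) - 4 * ε) ^ p *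
        (ballCapacity n p * (volume.real (Ω \ Metric.ball 0 S') /
          volume.real (Metric.ball (0 : EuclideanSpace ℝ (Fin n)) 1)) ^ ((n - p) / n)))) ≤
      ∫⁻ x, ENNReal.ofReal (‖gradient w x‖ ^ p) := by
  have hp0 : 0 < p := by linarith
  have hp1 : 0 < p - 1 := by linarith
  have hS'0 : 0 < S' := hS.trans hSS'
  set a := (n - p) / (p - 1) with ha
  have ha0 : 0 < a := div_pos (by linarith) hp1
  set θ := barrierSlope p with hθ
  have hθ0 : 0 < θ := barrierSlope_pos hp
  have hθ1 : θ ≤ 1 := barrierSlope_le_one hp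
  have hε2 : 0 < 2 * ε := by linarith
  -- The thresholds are such that `η₁' = 1` wherever `η₂' ≠ 0`.
  obtain ⟨η₁, η₁', hη₁, hη₁', -, h10, -, h12, h1nn, h1le, -⟩ := exists_smooth_posPart hε
  obtain ⟨η₂, η₂', hη₂, hη₂', -, h20, h20', -, h2nn, h2le, h2ge⟩ := exists_smooth_posPart hε2
  have hw1s : ContDiff ℝ 1 w := hw.of_le (by exact_mod_cast le_top)
  have hwd : Differentiable ℝ w := hw1s.differentiable one_ne_zero
  set φ₁ := barrierExcess η₁ w a S 1 with hφ₁
  set φ₂ := barrierExcess η₂ w a S θ with hφ₂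
  have sφ₁ : ContDiff ℝ ((⊤ : ℕ∞) : WithTop ℕ∞) φ₁ :=
    contDiff_barrierExcess hε h10 hη₁ ha0 hS zero_le_one hw1 hw
  have sφ₂ : ContDiff ℝ ((⊤ : ℕ∞) : WithTop ℕ∞) φ₂ :=
    contDiff_barrierExcess hε2 h20 hη₂ ha0 hS hθ0.le hw1 hw
  have sφ₁1 : ContDiff ℝ 1 φ₁ := sφ₁.of_le (by exact_mod_cast le_top)
  have sφ₂1 : ContDiff ℝ 1 φ₂ := sφ₂.of_le (by exact_mod_cast le_top)
  have cφ₁ : HasCompactSupport φ₁ := hasCompactSupport_barrierExcess hε h10 hS zero_le_one le_rfl hc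
  have cφ₂ : HasCompactSupport φ₂ := hasCompactSupport_barrierExcess hε2 h20 hS hθ0.le hθ1 hc
  -- The function `v` is a smooth version of the minimum of `w` and the potential. It equals `w` on the
  -- ball of radius `S`, so that it is admissible for `Ω ∩ B_S`.
  set v : EuclideanSpace ℝ (Fin n) → ℝ := fun x => w x - φ₁ x with hv
  have sv : ContDiff ℝ ((⊤ : ℕ∞) : WithTop ℕ∞) v := hw.sub sφ₁
  have cv : HasCompactSupport v := hc.sub cφ₁
  have hvΩ : ∀ x ∈ Ω ∩ Metric.ball 0 S, 1 ≤ v x := by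
    rintro x ⟨hx, hxS⟩
    have : φ₁ x = 0 := if_pos (mem_ball_zero_iff.1 hxS)
    simp only [hv, this, hwΩ x hx, sub_zero, le_refl]
  set A : EuclideanSpace ℝ (Fin n) → EuclideanSpace ℝ (Fin n) := potentialGradient a S with hA
  obtain ⟨fi₁, fI₁⟩ := integral_potential_flux_inner_gradient hp hpn hS sφ₁1 cφ₁
    (barrierExcess_eventuallyEq_zero _ _ _ _ hS)
  obtain ⟨fi₂, fI₂⟩ := integral_potential_flux_inner_gradient hp hpn hS sφ₂1 cφ₂
    (barrierExcess_eventuallyEq_zero _ _ _ _ hS)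
  rw [← ha, ← hA] at fi₁ fI₁ fi₂ fI₂
  have iv := integrable_rpow_norm_gradient hp0 (sv.of_le (by exact_mod_cast le_top)) cv
  have i2 := integrable_rpow_norm_gradient hp0 sφ₂1 cφ₂
  have iw := integrable_rpow_norm_gradient hp0 hw1s hc
  have pointwise : ∀ᵐ x, ‖gradient v x‖ ^ p + barrierConst p * ‖gradient φ₂ x‖ ^ p +
      p * (‖A x‖ ^ (p - 2) * inner ℝ (A x) (gradient φ₁ x)) -
      p * (‖A x‖ ^ (p - 2) * inner ℝ (A x) (gradient φ₂ x)) ≤ ‖gradient w x‖ ^ p := by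
    have hn : Nonempty (Fin n) := ⟨⟨0, by exact_mod_cast (by linarith : (0 : ℝ) < n)⟩⟩
    filter_upwards [Measure.ae_ne volume (0 : EuclideanSpace ℝ (Fin n))] with x hx
    have g1 := hasGradientAt_barrierExcess (S := S) hε h10 hη₁' ha0 zero_le_one hw1 hwd hx
    have g2 := hasGradientAt_barrierExcess (S := S) hε2 h20 hη₂' ha0 hθ0.le hw1 hwd hx
    have gv : HasGradientAt v _ x := (hwd x).hasGradientAt.sub g1
    rw [gv.gradient, g1.gradient, g2.gradient, one_smul]
    refine rpow_norm_add_le_of_barrier _ _ hp (h2nn _) ?_ (h1le _)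
    rcases le_or_gt (w x - (1 - θ * (1 - S ^ a * ‖x‖ ^ (-a)))) (2 * ε) with h | h
    · rw [h20' _ h]; exact h1nn _
    · -- Above the barrier `w` exceeds the potential as well, since the potential is at most one.
      rw [h12]
      · exact h2le _
      have hle : S ^ a * ‖x‖ ^ (-a) ≤ 1 := by
        by_contra! hgt
        have : θ * (1 - S ^ a * ‖x‖ ^ (-a)) ≤ 0 :=
          mul_nonpos_of_nonneg_of_nonpos hθ0.le (by linarith)
        linarith [hw1 x]
      have : θ * (1 - S ^ a * ‖x‖ ^ (-a)) ≤ 1 * (1 - S ^ a * ‖x‖ ^ (-a)) :=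
        mul_le_mul_of_nonneg_right hθ1 (by linarith)
      linarith
  have energy : (∫ x, ‖gradient v x‖ ^ p) + barrierConst p * ∫ x, ‖gradient φ₂ x‖ ^ p ≤
      ∫ x, ‖gradient w x‖ ^ p := by
    have := integral_mono_ae (((iv.add (i2.const_mul _)).add (fi₁.const_mul p)).sub
      (fi₂.const_mul p)) iw pointwise
    rw [integral_sub' ((iv.add (i2.const_mul _)).add (fi₁.const_mul p)) (fi₂.const_mul p),
      integral_add' (iv.add (i2.const_mul _)) (fi₁.const_mul p),
      integral_add' iv (i2.const_mul _), integral_const_mul, integral_const_mul,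
      integral_const_mul, fI₁, fI₂] at this
    simpa using this
  have hD : ∀ x ∈ Ω \ Metric.ball 0 S', θ * (1 - (S / S') ^ a) - 4 * ε ≤ φ₂ x := by
    rintro x ⟨hx, hxS'⟩
    rw [Metric.mem_ball, dist_zero_right, not_lt] at hxS'
    have hx0 : 0 < ‖x‖ := hS'0.trans_le hxS'
    have h1 : φ₂ x = _ := barrierExcess_of_ne_zero hε2 h20 ha0 hθ0.le hw1 (norm_pos_iff.1 hx0)
    have h2 : S ^ a * ‖x‖ ^ (-a) ≤ (S / S') ^ a := by
      rw [Real.rpow_neg hx0.le, ← div_eq_mul_inv, Real.div_rpow hS.le hS'0.le]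
      gcongr
    have h3 : θ * (1 - (S / S') ^ a) ≤ θ * (1 - S ^ a * ‖x‖ ^ (-a)) := by gcongr
    rw [h1]
    refine le_trans ?_ (h2ge _)
    rw [hwΩ x hx]
    linarith
  have hcp := barrierConst_pos hp
  have toL : ∀ f : EuclideanSpace ℝ (Fin n) → ℝ, Integrable (fun x => ‖gradient f x‖ ^ p) →
      ∫⁻ x, ENNReal.ofReal (‖gradient f x‖ ^ p) = ENNReal.ofReal (∫ x, ‖gradient f x‖ ^ p) :=
    fun f hf => (ofReal_integral_eq_lintegral_ofReal hf
      (Filter.Eventually.of_forall fun x => by positivity)).symm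
  calc _ ≤ (∫⁻ x, ENNReal.ofReal (‖gradient v x‖ ^ p)) +
        ENNReal.ofReal (barrierConst p) * ∫⁻ x, ENNReal.ofReal (‖gradient φ₂ x‖ ^ p) := by
        refine add_le_add (pCapacity_le sv cv hvΩ) ?_
        rw [ENNReal.ofReal_mul hcp.le]
        gcongr
        exact mul_rpow_volume_le_lintegral hp hpn hμ sφ₂1 cφ₂ hD
    _ = ENNReal.ofReal ((∫ x, ‖gradient v x‖ ^ p) + barrierConst p * ∫ x, ‖gradient φ₂ x‖ ^ p) := by
        rw [toL v iv, toL φ₂ i2, ← ENNReal.ofReal_mul hcp.le, ← ENNReal.ofReal_add]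
        · exact integral_nonneg fun x => by positivity
        · exact mul_nonneg hcp.le (integral_nonneg fun x => by positivity)
    _ ≤ ENNReal.ofReal (∫ x, ‖gradient w x‖ ^ p) := ENNReal.ofReal_le_ofReal energy
    _ = _ := (toL w iw).symm

/-- The energy gap for the capacity, with the slopes of all truncations taken to the limit. -/
theorem pCapacity_inter_add_le {p S S' : ℝ} (hp : 1 < p) (hpn : p < n) (hS : 0 < S)
    (hSS' : S < S') (Ω : Set (EuclideanSpace ℝ (Fin n))) :
    pCapacity p (Ω ∩ Metric.ball 0 S) + ENNReal.ofReal (barrierConst p *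
      ((barrierSlope p * (1 - (S / S') ^ ((n - p) / (p - 1)))) ^ p *
        (ballCapacity n p * (volume.real (Ω \ Metric.ball 0 S') /
          volume.real (Metric.ball (0 : EuclideanSpace ℝ (Fin n)) 1)) ^ ((n - p) / n)))) ≤
      pCapacity p Ω := by
  have hp0 : 0 < p := by linarith
  have ha0 : 0 < (n - p) / (p - 1) := div_pos (by linarith) (by linarith)
  have hS'0 : 0 < S' := hS.trans hSS'
  set μ := barrierSlope p * (1 - (S / S') ^ ((n - p) / (p - 1))) with hμ
  have hμ0 : 0 < μ := by
    have : (S / S') ^ ((n - p) / (p - 1)) < 1 :=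
      Real.rpow_lt_one (by positivity) ((div_lt_one hS'0).2 hSS') ha0
    exact mul_pos (barrierSlope_pos hp) (by linarith)
  set M := ballCapacity n p * (volume.real (Ω \ Metric.ball 0 S') /
    volume.real (Metric.ball (0 : EuclideanSpace ℝ (Fin n)) 1)) ^ ((n - p) / n) with hM
  refine le_iInf fun u => le_iInf fun hu => le_iInf fun hc => le_iInf fun h1 => ?_
  have key : ∀ ε, 0 < ε → ε < μ / 4 →
      pCapacity p (Ω ∩ Metric.ball 0 S) + ENNReal.ofReal (barrierConst p * ((μ - 4 * ε) ^ p * M)) ≤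
        ENNReal.ofReal ((1 + ε) ^ p) * ∫⁻ x, ENNReal.ofReal (‖gradient u x‖ ^ p) := by
    intro ε hε hεμ
    -- Truncating `u` at one costs a factor `(1 + ε) ^ p` of energy.
    obtain ⟨σ, σ', s₀, s₁, hσ, hσ', hs₀, hs₁, hσ0, hσ1, hσle, hσ'0, hσ'1⟩ := exists_smooth_clamp hε
    refine (pCapacity_inter_add_le_lintegral (w := fun x => σ (u x)) hp hpn hS hSS' hε
      (hσ.comp hu) (hc.comp_left (hσ0 0 hs₀.le)) (fun x => hσle _)
      (fun x hx => hσ1 _ (hs₁.le.trans (h1 x hx))) (by linarith)).trans ?_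
    rw [← lintegral_const_mul' _ _ ENNReal.ofReal_ne_top]
    refine lintegral_mono fun x => ?_
    have hud : DifferentiableAt ℝ u x := hu.differentiable (by simp) x
    have hg := (hσ' (u x)).comp_hasGradientAt hud.hasGradientAt
    rw [hg.gradient, norm_smul, Real.norm_of_nonneg (hσ'0 _), ← ENNReal.ofReal_mul (by positivity),
      ← Real.mul_rpow (by positivity) (norm_nonneg _)]
    have := hσ'0 (u x)
    refine ENNReal.ofReal_le_ofReal ?_
    gcongr
    exact hσ'1 _
  have lim1 : Filter.Tendsto (fun ε : ℝ => pCapacity p (Ω ∩ Metric.ball 0 S) +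
      ENNReal.ofReal (barrierConst p * ((μ - 4 * ε) ^ p * M))) (nhdsWithin 0 (Set.Ioi 0))
      (nhds (pCapacity p (Ω ∩ Metric.ball 0 S) + ENNReal.ofReal (barrierConst p * (μ ^ p * M)))) := by
    have hcont : Continuous fun ε : ℝ => ENNReal.ofReal (barrierConst p * ((μ - 4 * ε) ^ p * M)) :=
      ENNReal.continuous_ofReal.comp (continuous_const.mul
        (((continuous_const.sub (continuous_const.mul continuous_id)).rpow_const
          fun _ => Or.inr hp0.le).mul continuous_const))
    have := (hcont.tendsto 0).mono_left (nhdsWithin_le_nhds (s := Set.Ioi 0))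
    rw [mul_zero, sub_zero] at this
    exact tendsto_const_nhds.add this
  have lim2 : Filter.Tendsto (fun ε : ℝ => ENNReal.ofReal ((1 + ε) ^ p) *
      ∫⁻ x, ENNReal.ofReal (‖gradient u x‖ ^ p)) (nhdsWithin 0 (Set.Ioi 0))
      (nhds (∫⁻ x, ENNReal.ofReal (‖gradient u x‖ ^ p))) := by
    have hcont : Continuous fun ε : ℝ => ENNReal.ofReal ((1 + ε) ^ p) :=
      ENNReal.continuous_ofReal.comp
        ((continuous_const.add continuous_id).rpow_const fun _ => Or.inr hp0.le)
    have := (hcont.tendsto 0).mono_left (nhdsWithin_le_nhds (s := Set.Ioi 0))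
    simp only [add_zero, Real.one_rpow, ENNReal.ofReal_one] at this
    simpa using ENNReal.Tendsto.mul_const this (Or.inl one_ne_zero)
  refine le_of_tendsto_of_tendsto lim1 lim2 ?_
  filter_upwards [Ioo_mem_nhdsGT (show (0 : ℝ) < μ / 4 by linarith)] with ε hε
  exact key ε hε.1 hε.2

end

/-- Bernoulli's inequality for arbitrary positive exponents. -/
theorem min_one_mul_le_one_sub_rpow {a s : ℝ} (ha : 0 < a) (hs0 : 0 ≤ s) (hs1 : s ≤ 1) :
    min 1 a * (1 - s) ≤ 1 - s ^ a := by
  rcases le_total 1 a with h | h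
  · rw [min_eq_left h]
    have := Real.rpow_le_self_of_le_one hs0 hs1 h
    linarith
  · rw [min_eq_right h]
    have := rpow_one_add_le_one_add_mul_self (by linarith : -1 ≤ s - 1) ha.le h
    rw [add_sub_cancel] at this
    linarith

theorem mainTheorem6 (N : ℕ) (p : ℝ) (hp : 1 < p) (hpN : p < N) (S' : ℝ) (hS' : 0 < S') :
    ∃ c : ℝ, 0 < c ∧
      ∀ S : ℝ, 0 < S → S < S' →
      ∀ Ω : Set (EuclideanSpace ℝ (Fin N)), IsOpen Ω →
        volume Ω = volume (Metric.ball (0 : EuclideanSpace ℝ (Fin N)) 1) →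
        pCapacity p (Metric.ball (0 : EuclideanSpace ℝ (Fin N)) 1) *
            ENNReal.ofReal
              ((1 - volume.real (Ω \ Metric.ball 0 S) /
                  volume.real (Metric.ball (0 : EuclideanSpace ℝ (Fin N)) 1)) ^ ((N - p) / N))
          ≤ pCapacity p (Ω ∩ Metric.ball 0 S) ∧
        pCapacity p (Ω ∩ Metric.ball 0 S) +
            ENNReal.ofReal
              (c * (1 - S / S') ^ p * volume.real (Ω \ Metric.ball 0 S') ^ ((N - p) / N))
          ≤ pCapacity p Ω := by
  have hω0 : 0 < volume.real (Metric.ball (0 : EuclideanSpace ℝ (Fin N)) 1) :=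
    ENNReal.toReal_pos (Metric.measure_ball_pos _ _ one_pos).ne' measure_ball_lt_top.ne
  set ω := volume.real (Metric.ball (0 : EuclideanSpace ℝ (Fin N)) 1) with hω
  have ha0 : 0 < (N - p) / (p - 1) := div_pos (by linarith) (by linarith)
  have hp0 : 0 < p := by linarith
  set a := (N - p) / (p - 1) with ha
  have hκ := ballCapacity_pos hp hpN
  have hb := barrierConst_pos hp
  have hθ := barrierSlope_pos hp
  refine ⟨barrierConst p * ((barrierSlope p * min 1 a) ^ p *
    (ballCapacity N p / ω ^ ((N - p) / N))), by positivity, ?_⟩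
  intro S hS hSS' Ω hΩ hvol
  constructor
  · -- The isocapacitary inequality for `Ω ∩ B_S`, which has volume `|B_1| - |Ω \ B_S|`.
    refine (mul_le_mul_left (pCapacity_ball_le hp hpN) _).trans ?_
    refine le_iInf fun u => le_iInf fun hu => le_iInf fun hc => le_iInf fun h1 => ?_
    have hmeas : volume.real (Ω ∩ Metric.ball 0 S) = ω - volume.real (Ω \ Metric.ball 0 S) := by
      have h := measureReal_inter_add_sdiff (μ := volume) (s := Ω) (measurableSet_ball (x := 0) (ε := S))
        (by rw [hvol]; exact measure_ball_lt_top.ne)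
      have h2 : volume.real Ω = ω := by rw [Measure.real, hvol]; rfl
      linarith
    have := mul_rpow_volume_le_lintegral hp hpN one_pos (hu.of_le (by exact_mod_cast le_top)) hc h1
    rw [← ENNReal.ofReal_mul hκ.le]
    rwa [Real.one_rpow, one_mul, hmeas, ← hω, sub_div, div_self hω0.ne'] at this
  · refine le_trans ?_ (pCapacity_inter_add_le hp hpN hS hSS' Ω)
    have hs : S / S' < 1 := (div_lt_one hS').2 hSS'
    have hmin := min_one_mul_le_one_sub_rpow ha0 (by positivity) hs.le
    have hm0 : 0 < min 1 a := by positivity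
    have hs' : 0 < 1 - S / S' := by linarith
    refine add_le_add le_rfl (ENNReal.ofReal_le_ofReal ?_)
    rw [← hω, Real.div_rpow measureReal_nonneg hω0.le]
    calc _ = barrierConst p * ((barrierSlope p * (min 1 a * (1 - S / S'))) ^ p *
          (ballCapacity N p * (volume.real (Ω \ Metric.ball 0 S') ^ ((N - p) / N) /
            ω ^ ((N - p) / N)))) := by
          rw [← mul_assoc (barrierSlope p), Real.mul_rpow (by positivity) hs'.le]
          ring
      _ ≤ _ := by gcongr
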